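/- Let $\mathbb{F}_q$ be a finite field with $q$ elements, $K_\infty=\mathbb{F}_q((1/\theta))$ with the absolute value normalised by $|\theta|=q$, and $\mathbb{C}_\infty$ the completion of an algebraic closure of $K_\infty$. Let $\phi$ be a Drinfeld $\mathbb{F}_q[x]$-module of rank $r\ge 1$ over $\mathbb{C}_\infty$, i.e. $\phi_x=\theta+g_1\tau+\dots+g_r\tau^r$ with $g_i\in\mathbb{C}_\infty$, $g_r\neq 0$, where $\tau$ is the $q$-power Frobenius; let $\exp_\phi(\mu)=\sum_{i\ge0}e_i\mu^{q^i}$, $e_0=1$, be its exponential, i.e. the power series of this form with $\exp_\phi(\theta\mu)=\phi_x(\exp_\phi(\mu))$ (it converges on all of $\mathbb{C}_\infty$), and $\Lambda_\phi=\{z:\exp_\phi(z)=0\}$ its lattice. Let $\mathbb{T}$ be the Tate algebra of power series $\sum c_it^i$ over $\mathbb{C}_\infty$ with $c_i\to0$, and for $\omega=\sum c_i t^i$ let $\omega^{(k)}=\sum c_i^{q^k}t^i$. Let $\mathfrak{f}=\sum_{i=0}^n a_it^i\in\mathbb{F}_q[t]$ be monic of degree $n\ge1$. The $\mathfrak f$-remainder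 $[\omega]_{\mathfrak f}$ of $\omega\in\mathbb{T}$ is the polynomial of degree $<n$ in $\mathbb{C}_\infty[t]$ representing $\omega(\bar t)\in\mathbb{C}_\infty[t]/(\mathfrak f)$. Put $\mathrm{D}_{\mathfrak f}(X^k)=\sum_{j=0}^{n-k-1}a_{k+j+1}X^j$ for $0\le k<n$ and $\mathrm{O}^{(2)}_{\mathfrak f}(X_1,X_2)=\sum_{k=0}^{n-1}\mathrm{D}_{\mathfrak f}(X_1^k)X_2^k$, and for $s\ge1$ let the Weil operator $\mathrm{O}^{(s)}_{\mathfrak f}(X_1,\dots,X_s)\in\mathbb{F}_q[X_1,\dots,X_s]$ be the polynomial of degree $<n$ in each variable that is congruent to $\prod_{j=1}^{s-1}\mathrm{O}^{(2)}_{\mathfrak f}(X_j,X_s)$ modulo $\mathfrak f(X_s)$ (so $\mathrm{O}^{(1)}_{\mathfrak f}=1$). For $\mu_1,\dots,\mu_r\in\mathbb{C}_\infty$ the monomial $X_1^{b_1}\cdots X_r^{b_r}$ acts by $X_1^{b_1}\cdots X_r^{b_r}\diamond_\phi(\mu_1\otimes\dots\otimes\mu_r)=\phi_{x^{b_1}}(\mu_1)\otimes\dots\otimes\phi_{x^{b_r}}(\mu_r)$.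 This is extended $\mathbb{F}_q$-linearly to an action of $\mathbb{F}_q[X_1,\dots,X_r]$ with values in $\mathbb{C}_\infty^{\otimes_{\mathbb{F}_q}r}$, and $\mathbb{F}_q[t]$-linearly to an action of $\mathbb{F}_q[X_1,\dots,X_r,t]$ with values in $\mathbb{C}_\infty[t]^{\otimes_{\mathbb{F}_q[t]}r}$. The Moore determinant $\mathcal M$ sends $\omega_1\otimes\dots\otimes\omega_r$ to $\det(\omega_i^{(j-1)})_{1\le i,j\le r}$; it is used on $\mathbb{C}_\infty$ (where $\mu^{(k)}=\mu^{q^k}$), on $\mathbb{C}_\infty[t]$ and on power series. Finally let $\phi[\mathfrak f]=\ker\phi_{\mathfrak f}$, let $\psi$ be the rank-one Drinfeld module $\psi_x=\theta+(-1)^{r-1}g_r\tau$, and for $\mu_i\in\phi[\mathfrak f]$ let Katen's Weil pairing be $\mathrm{Weil}_{\mathfrak f}(\mu_1,\dots,\mu_r)=\mathcal M(\mathrm{O}^{(r)}_{\mathfrak f}\diamond_\phi(\mu_1\otimes\dots\otimes\mu_r))$. Theorem. Let $z_1,\dots,z_r\in\Lambda_\phi$, let $\omega_{z_i}(t)=\sum_{k\ge0}\exp_\phi(z_i/\theta^{k+1})t^k$,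 and let $\kappa=\mathcal M(\omega_{z_1},\dots,\omega_{z_r})$. Then $\omega_{z_1},\dots,\omega_{z_r}$ and $\kappa$ lie in $\mathbb{T}$. Write $C_{z_i,n-1}$ for the coefficient of $t^{n-1}$ in $[\omega_{z_i}]_{\mathfrak f}$ and $[\kappa]_{\mathfrak f}=\sum_{j=0}^{n-1}K_jt^j$. Then: (1) $\displaystyle\sum_{j=0}^{n-1}K_jt^j=\mathcal M\bigl(\mathrm{O}^{(r+1)}_{\mathfrak f}(X_1,\dots,X_r,t)\diamond_\phi(C_{z_1,n-1}\otimes\dots\otimes C_{z_r,n-1})\bigr)$; (2) $C_{z_1,n-1},\dots,C_{z_r,n-1}\in\phi[\mathfrak f]$, and $K_{n-1}=\mathrm{Weil}_{\mathfrak f}(C_{z_1,n-1},\dots,C_{z_r,n-1})\in\psi[\mathfrak f]$. -/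

import Mathlib

open Polynomial
open scoped NNReal WithZero PowerSeries TensorProduct

noncomputable section

namespace DrinfeldWeil

/-! ### The field of constants -/

section Field

variable (Fq : Type*) [Field Fq]

/-- The field `K_∞ = 𝔽_q((1/θ))`, as formal Laurent series in the variable `1/θ`. -/
def KInf : Type _ := LaurentSeries Fq

instance : Field (KInf Fq) := inferInstanceAs (Field (LaurentSeries Fq))

instance : Algebra Fq (KInf Fq) := inferInstanceAs (Algebra Fq (LaurentSeries Fq))

instance : Valued (KInf Fq) ℤᵐ⁰ := inferInstanceAs (Valued (LaurentSeries Fq) ℤᵐ⁰)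

instance : CompleteSpace (KInf Fq) := inferInstanceAs (CompleteSpace (LaurentSeries Fq))

/-- The element `θ` of `K_∞`, the inverse of the variable of the Laurent series. -/
def thetaKInf : KInf Fq := (HahnSeries.single (-1 : ℤ) (1 : Fq) : LaurentSeries Fq)

lemma valued_theta : Valued.v (thetaKInf Fq) = WithZero.exp (1 : ℤ) := by
  have h := LaurentSeries.valuation_single_zpow Fq (-1)
  rw [neg_neg] at h
  exact h

variable [Fintype Fq]

lemma one_lt_q : (1 : ℝ≥0) < (Fintype.card Fq : ℝ≥0) := by
  exact_mod_cast Fintype.one_lt_card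

/-- The valuation at infinity as a real valued one, normalised by `|θ| = q`. -/
instance : (Valued.v : Valuation (KInf Fq) ℤᵐ⁰).RankOne where
  hom' := (WithZeroMulInt.toNNReal (one_lt_q Fq).ne_bot).comp
    MonoidWithZeroHom.ValueGroup₀.embedding
  strictMono' := (WithZeroMulInt.toNNReal_strictMono (one_lt_q Fq)).comp
    MonoidWithZeroHom.ValueGroup₀.embedding_strictMono
  exists_val_nontrivial := by
    refine ⟨thetaKInf Fq, ?_, ?_⟩ <;> rw [valued_theta] <;> decide

instance : NormedField (KInf Fq) := Valued.toNormedField (KInf Fq) ℤᵐ⁰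

lemma norm_thetaKInf : ‖thetaKInf Fq‖ = Fintype.card Fq := by
  have h : ‖thetaKInf Fq‖ = ((WithZeroMulInt.toNNReal (one_lt_q Fq).ne_bot)
      (MonoidWithZeroHom.ValueGroup₀.embedding
        ((Valued.v : Valuation (KInf Fq) ℤᵐ⁰).restrict (thetaKInf Fq))) : ℝ) := rfl
  rw [h, Valuation.embedding_restrict, valued_theta,
    WithZeroMulInt.toNNReal_neg_apply _ WithZero.exp_ne_zero]
  have h2 : WithZero.unzero (WithZero.exp_ne_zero (a := (1 : ℤ))) = Multiplicative.ofAdd 1 := rfl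
  rw [h2]
  simp

instance : NontriviallyNormedField (KInf Fq) where
  non_trivial := ⟨thetaKInf Fq, by rw [norm_thetaKInf]; exact_mod_cast Fintype.one_lt_card⟩

instance : IsUltrametricDist (KInf Fq) :=
  IsUltrametricDist.isUltrametricDist_of_forall_norm_add_le_max_norm
    (Valuation.norm_add_le (Valued.v : Valuation (KInf Fq) ℤᵐ⁰))

/-- An algebraic closure of `K_∞`. -/
abbrev KInfBar := AlgebraicClosure (KInf Fq)

/-- The unique extension of the absolute value of `K_∞`. -/
instance : NormedField (KInfBar Fq) := spectralNorm.normedField (KInf Fq) (KInfBar Fq)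

instance : UniformContinuousConstSMul Fq (KInfBar Fq) where
  uniformContinuous_const_smul c := by
    simp only [Algebra.smul_def]
    exact (lipschitzWith_smul (algebraMap Fq (KInfBar Fq) c)).uniformContinuous

/-- The field `ℂ_∞`: the completion of the algebraic closure of `K_∞`. -/
abbrev CInf := UniformSpace.Completion (KInfBar Fq)

/-- The element `θ` of `ℂ_∞`. -/
def theta : CInf Fq := ((algebraMap (KInf Fq) (KInfBar Fq) (thetaKInf Fq) : KInfBar Fq) : CInf Fq)

lemma norm_theta : ‖theta Fq‖ = Fintype.card Fq := by
  rw [theta, UniformSpace.Completion.norm_coe]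
  exact (spectralNorm_extends (thetaKInf Fq)).trans (norm_thetaKInf Fq)

instance : IsUltrametricDist (KInfBar Fq) :=
  IsUltrametricDist.isUltrametricDist_of_forall_norm_add_le_max_norm
    (isNonarchimedean_spectralNorm (K := KInf Fq) (L := KInfBar Fq))

instance : IsUltrametricDist (CInf Fq) where
  dist_triangle_max x y z := by
    refine UniformSpace.Completion.induction_on₃ x y z ?_ fun a b c => ?_
    · exact isClosed_le (by fun_prop) (by fun_prop)
    · simp only [UniformSpace.Completion.dist_eq]
      exact dist_triangle_max a b c


/-- The Frobenius `x ↦ x ^ q` of `ℂ_∞`. -/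
abbrev frob : CInf Fq →ₐ[Fq] CInf Fq := FiniteField.frobeniusAlgHom Fq (CInf Fq)

/-- The Frobenius twist `ω ↦ ω⁽¹⁾` of power series: `q`-th powers of all coefficients. -/
def twistPowerSeries : (CInf Fq)⟦X⟧ →ₐ[Fq] (CInf Fq)⟦X⟧ := PowerSeries.mapAlgHom (frob Fq)

/-- The Tate algebra: power series over `ℂ_∞` whose coefficients tend to zero. -/
def tateAlgebra : Subring (CInf Fq)⟦X⟧ := PowerSeries.IsRestricted.subring 1

lemma mem_tateAlgebra (ω : (CInf Fq)⟦X⟧) : ω ∈ tateAlgebra Fq ↔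
    Filter.Tendsto (fun i => ‖PowerSeries.coeff i ω‖) Filter.atTop (nhds 0) := by
  have h : ω ∈ tateAlgebra Fq ↔ PowerSeries.IsRestricted 1 ω := Iff.rfl
  rw [h, PowerSeries.isRestricted_iff']
  simp

end Field

/-! ### Moore determinants -/

section Moore

variable {R S : Type*} [CommRing R] [CommRing S] [Algebra R S]

/-- The Moore determinant `ω₁ ⊗ ⋯ ⊗ ω_r ↦ det (τ^j ω_i)`, `0 ≤ j < r`, for an endomorphism `τ` of
the `R`-algebra `S`, as an `R`-linear map on the `r`-th tensor power. -/
def moore (τ : S →ₐ[R] S) (r : ℕ) : (⨂[R] _ : Fin r, S) →ₗ[R] S :=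
  PiTensorProduct.lift
    (((Matrix.detRowAlternating (n := Fin r) (R := S)).toMultilinearMap.restrictScalars
      R).compLinearMap fun _ => LinearMap.pi fun j : Fin r => (τ ^ (j : ℕ)).toLinearMap)

lemma moore_tprod (τ : S →ₐ[R] S) (r : ℕ) (ω : Fin r → S) :
    moore τ r (PiTensorProduct.tprod R ω) =
      (Matrix.of fun j i : Fin r => (τ ^ (j : ℕ)) (ω i)).det := by
  rw [moore, PiTensorProduct.lift.tprod, ← Matrix.det_transpose]
  rfl

end Moore

/-! ### Weil operators -/

section WeilOperator

variable {Fq : Type*} [Field Fq]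

/-- `D_𝔣(t^i) = ∑_{j=0}^{n-i-1} a_{i+j+1} t^j` for `𝔣 = ∑ a_i t^i` of degree `n` and `i < n`. -/
def dualPoly (f : Fq[X]) (i : ℕ) : Fq[X] :=
  ∑ j ∈ Finset.range (f.natDegree - i), C (f.coeff (i + j + 1)) * X ^ j

/-- The product `∏_{j<r} O_𝔣⁽²⁾(X_j, X_r)` with `r = s + 1`, as a polynomial in the last variable
`X_r`, where `O_𝔣⁽²⁾(X_j, X_r) = ∑_{k<n} D_𝔣(X_j^k) X_r^k`. -/
def weilProd (f : Fq[X]) (s : ℕ) : (MvPolynomial (Fin s) Fq)[X] :=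
  ∏ j : Fin s, ∑ k ∈ Finset.range f.natDegree,
    C (aeval (MvPolynomial.X j : MvPolynomial (Fin s) Fq) (dualPoly f k)) * X ^ k

/-- The Weil operator `O_𝔣⁽ʳ⁾` of rank `r ≥ 1` for a monic nonconstant `𝔣`: the product
`∏_{j<r} O_𝔣⁽²⁾(X_j, X_r)`, reduced modulo `𝔣(X_r)`. (The value at `r = 0` is immaterial.) -/
def weilOp (f : Fq[X]) : (r : ℕ) → MvPolynomial (Fin r) Fq
  | 0 => 1
  | s + 1 => eval₂ (MvPolynomial.rename Fin.castSucc : _ →ₐ[Fq] MvPolynomial (Fin (s + 1)) Fq)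
      (MvPolynomial.X (Fin.last s)) (weilProd f s %ₘ f.map MvPolynomial.C)

/-- A polynomial in `X_1, …, X_{r+1}` seen as a polynomial `F(X_1, …, X_r, t)` in `X_1, …, X_r`
with coefficients in `𝔽_q[t]`. -/
def lastVarToT {r : ℕ} (F : MvPolynomial (Fin (r + 1)) Fq) : MvPolynomial (Fin r) Fq[X] :=
  MvPolynomial.aeval (Fin.snoc (fun i => MvPolynomial.X i) (MvPolynomial.C X) :
    Fin (r + 1) → MvPolynomial (Fin r) Fq[X]) F

end WeilOperator

/-! ### Drinfeld modules -/

section Drinfeld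

variable (Fq : Type*) [Field Fq] [Fintype Fq]

/-- A Drinfeld `𝔽_q[x]`-module of rank `r ≥ 1` over `ℂ_∞`, given by the coefficients of
`φ_x = g_0 + g_1 τ + ⋯ + g_r τ^r` with `g_0 = θ` and `g_r ≠ 0`. -/
structure DrinfeldModule (r : ℕ) where
  /-- The coefficients `g_0, …, g_r`. -/
  g : Fin (r + 1) → CInf Fq
  rank_pos : 0 < r
  g_zero : g 0 = theta Fq
  g_last : g (Fin.last r) ≠ 0

namespace DrinfeldModule

variable {Fq} {r : ℕ} (φ : DrinfeldModule Fq r)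

/-- The operator `φ_x = ∑ g_i τ^i` on `ℂ_∞`. -/
def phiX : Module.End Fq (CInf Fq) :=
  ∑ i : Fin (r + 1), φ.g i • (frob Fq).toLinearMap ^ (i : ℕ)

/-- The `𝔽_q`-algebra homomorphism `a ↦ φ_a` with values in the operators on `ℂ_∞`. -/
def phi : Fq[X] →ₐ[Fq] Module.End Fq (CInf Fq) := aeval φ.phiX

/-- The `𝔣`-torsion `φ[𝔣]`. -/
def torsion (f : Fq[X]) : Submodule Fq (CInf Fq) := LinearMap.ker (φ.phi f)

/-- The coefficients `e_i = 1 / D_i` of the exponential `exp_φ(μ) = ∑ e_i μ^(q^i)`: `e_0 = 1`, and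
`e_i (θ^(q^i) - θ) = ∑_{1 ≤ j ≤ min (i, r)} g_j e_{i-j}^(q^j)`. -/
def expCoeff : ℕ → CInf Fq
  | 0 => 1
  | i + 1 => (theta Fq ^ Fintype.card Fq ^ (i + 1) - theta Fq)⁻¹ *
      ∑ j : Fin r, if (j : ℕ) ≤ i then
        φ.g j.succ * expCoeff (i - j) ^ Fintype.card Fq ^ ((j : ℕ) + 1) else 0
termination_by i => i
decreasing_by omega

/-- The functional equation `exp_φ(θ μ) = φ_x(exp_φ(μ))`, coefficient by coefficient. -/
lemma expCoeff_spec (i : ℕ) : φ.expCoeff i * theta Fq ^ Fintype.card Fq ^ i =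
    ∑ j : Fin (r + 1), if (j : ℕ) ≤ i then
      φ.g j * φ.expCoeff (i - j) ^ Fintype.card Fq ^ (j : ℕ) else 0 := by
  have hq : 1 < Fintype.card Fq := Fintype.one_lt_card
  rw [Fin.sum_univ_succ]
  cases i with
  | zero => simp [φ.g_zero, expCoeff]
  | succ i =>
    have hne : theta Fq ^ Fintype.card Fq ^ (i + 1) - theta Fq ≠ 0 := by
      intro h
      have h1 := congrArg norm (sub_eq_zero.mp h)
      rw [norm_pow, norm_theta] at h1
      have h2 : Fintype.card Fq ^ Fintype.card Fq ^ (i + 1) = Fintype.card Fq ^ 1 := by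
        rw [pow_one]; exact_mod_cast h1
      have h3 := Nat.pow_right_injective hq h2
      have h4 : 1 < Fintype.card Fq ^ (i + 1) := Nat.one_lt_pow (by omega) hq
      omega
    have h5 : ∀ j : Fin r, i + 1 - ((j : ℕ) + 1) = i - j := fun j => by omega
    have key : φ.expCoeff (i + 1) * (theta Fq ^ Fintype.card Fq ^ (i + 1) - theta Fq) =
        ∑ j : Fin r, if (j : ℕ) ≤ i then
          φ.g j.succ * φ.expCoeff (i - j) ^ Fintype.card Fq ^ ((j : ℕ) + 1) else 0 := by
      conv_lhs => rw [expCoeff]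
      field_simp
    simp only [Fin.val_zero, Fin.val_succ, add_le_add_iff_right, h5, φ.g_zero]
    rw [← key]
    simp
    ring

/-- The exponential function of `φ`. -/
def exp (μ : CInf Fq) : CInf Fq := ∑' i, φ.expCoeff i * μ ^ Fintype.card Fq ^ i

/-- The lattice of `φ`: the kernel of the exponential. -/
def lattice : Set (CInf Fq) := {z | φ.exp z = 0}

/-- The Anderson generating function `ω_z = ∑ exp_φ(z / θ^(k+1)) t^k`. -/
def omega (z : CInf Fq) : (CInf Fq)⟦X⟧ := PowerSeries.mk fun k => φ.exp (z / theta Fq ^ (k + 1))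

/-- The Moore determinant `κ` of `ω_{z_1}, …, ω_{z_r}`. -/
def kappa (z : Fin r → CInf Fq) : (CInf Fq)⟦X⟧ :=
  moore (twistPowerSeries Fq) r (PiTensorProduct.tprod Fq fun i => φ.omega (z i))

/-- The exterior product `ψ` of `φ`: the rank one module `ψ_x = θ + (-1)^(r-1) g_r τ`. -/
def exteriorProduct : DrinfeldModule Fq 1 where
  g := ![theta Fq, (-1) ^ (r - 1) * φ.g (Fin.last r)]
  rank_pos := one_pos
  g_zero := rfl
  g_last := by simpa using φ.g_last

/-- The Drinfeld action `F ⋄_φ (μ_1 ⊗ ⋯ ⊗ μ_r) ∈ ℂ_∞ ⊗ ⋯ ⊗ ℂ_∞` of `F ∈ 𝔽_q[X_1, …, X_r]`, where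
`X_1^{a_1} ⋯ X_r^{a_r}` acts by `φ_{x^{a_1}} ⊗ ⋯ ⊗ φ_{x^{a_r}}`. -/
def act (F : MvPolynomial (Fin r) Fq) (μ : Fin r → CInf Fq) : ⨂[Fq] _ : Fin r, CInf Fq :=
  ∑ a ∈ F.support, F.coeff a • PiTensorProduct.tprod Fq fun i => φ.phi (X ^ a i) (μ i)

/-- Katen's formula for the Weil pairing of `μ_1, …, μ_r ∈ φ[𝔣]`. -/
def weilPairing (f : Fq[X]) (μ : Fin r → φ.torsion f) : CInf Fq :=
  moore (frob Fq) r (φ.act (weilOp f r) fun i => μ i)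

end DrinfeldModule

attribute [local instance] Polynomial.algebra

/-- The Frobenius twist of `ℂ_∞[t]`: `q`-th powers of all coefficients, while `t` is fixed. It is
linear over `𝔽_q[t]`. -/
def twistPoly : (CInf Fq)[X] →ₐ[Fq[X]] (CInf Fq)[X] where
  toRingHom := mapRingHom (frob Fq : CInf Fq →+* CInf Fq)
  commutes' p := by
    ext i
    simp [Polynomial.algebraMap_def]

variable {Fq} {r : ℕ}

/-- The Drinfeld action of `F = ∑ F_a(t) X^a ∈ 𝔽_q[t][X_1, …, X_r]` on `μ_1 ⊗ ⋯ ⊗ μ_r`, with values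
in `ℂ_∞[t] ⊗ ⋯ ⊗ ℂ_∞[t]` (over `𝔽_q[t]`), where `𝔽_q[t]` acts by scalars. -/
def DrinfeldModule.actT (φ : DrinfeldModule Fq r) (F : MvPolynomial (Fin r) Fq[X])
    (μ : Fin r → CInf Fq) : ⨂[Fq[X]] _ : Fin r, (CInf Fq)[X] :=
  ∑ a ∈ F.support, F.coeff a • PiTensorProduct.tprod Fq[X] fun i => C (φ.phi (X ^ a i) (μ i))

/-- The Moore determinant on `ℂ_∞[t] ⊗ ⋯ ⊗ ℂ_∞[t]`. -/
def mooreT (T : ⨂[Fq[X]] _ : Fin r, (CInf Fq)[X]) : (CInf Fq)[X] := moore (twistPoly Fq) r T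

/-- The `𝔣`-remainder of a power series `ω = ∑ c_i t^i` in the Tate algebra, that is, the
polynomial of degree `< n = deg 𝔣` that represents `∑ c_i t̄^i` in `ℂ_∞[t] / 𝔣`, where the limit is
taken coefficientwise in the basis `1, t̄, …, t̄^{n-1}`. -/
def remainder (f : Fq[X]) (ω : (CInf Fq)⟦X⟧) : (CInf Fq)[X] :=
  ∑ j ∈ Finset.range f.natDegree,
    monomial j (∑' i, PowerSeries.coeff i ω * algebraMap Fq (CInf Fq) ((X ^ i %ₘ f).coeff j))

/-- The coefficient `C_{z,i}` of `t^i` in the `𝔣`-remainder of `ω_z`. -/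
def DrinfeldModule.remCoeff (φ : DrinfeldModule Fq r) (f : Fq[X]) (z : CInf Fq) (i : ℕ) :
    CInf Fq :=
  (remainder f (φ.omega z)).coeff i

end Drinfeld

end DrinfeldWeil

end

/-!
The argument rests on one formal property: call `ω` in the Tate algebra an eigenfunction of a
Drinfeld module `φ` if `φ_x(ω) = t ω`, with `φ_x` acting on coefficients. Comparing the coefficients
of the `𝔣`-remainder on both sides of this equation gives a recursion
`φ_x(C_j) = C_{j-1} - a_j C_{n-1}`, hence `C_j = φ_{D_𝔣(t^j)}(C_{n-1})` and, at `j = 0`,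
`φ_𝔣(C_{n-1}) = 0` (`coeff_remainder_eq_phi_dualPoly`, `coeff_remainder_mem_torsion`). There are two
kinds of eigenfunctions here.

* For a period `z` the series `ω_z` is an eigenfunction of `φ`, by the functional equation of the
  exponential (`phiX_coeff_omega`). It lies in the Tate algebra because the coefficients of the
  exponential decay so fast that `|exp_φ(μ)| ≤ |μ|` for small `μ` (`norm_exp_le`).
* The Moore determinant `κ` is an eigenfunction of the exterior product `ψ`: the difference equation
  of order `r` satisfied by all `ω_{z_i}` expresses `g_r τ^r(ω)` through lower twists, so that
  `g_r τ(κ)` is a multiple of `κ` (`mul_map_moore_tprod`).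

Evaluation at the class of `t` in `ℂ_∞[t] / 𝔣` is a ring homomorphism which commutes with the
Frobenius twist, so `[κ]_𝔣` is congruent to the Moore determinant of the polynomials
`[ω_{z_i}]_𝔣 = ∑_j φ_{D_𝔣(t^j)}(C_{z_i,n-1}) t^j`. That determinant is the value of the product
`∏_i O_𝔣⁽²⁾(X_i, t)` (`actT_lastVarHom_weilProd`). Reduction modulo `𝔣(t)` turns the product into
the Weil operator (`remainder_moore_eq`).

For the top coefficient, `O_𝔣⁽²⁾(x, X) = (𝔣(X) - 𝔣(x)) / (X - x)` is a reproducing kernel: modulo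
`𝔣(x)`, the coefficient of `X^(n-1)` in `P(X) O_𝔣⁽²⁾(x, X)` modulo `𝔣(X)` is `P(x)`
(`coeff_mul_weilTwo_modByMonic`). Hence the coefficient of `t^(n-1)` in the operator of rank `r + 1`
is the operator of rank `r` modulo `𝔣(X_r)`, and `𝔣(X_r)` acts as zero on torsion points.
-/

noncomputable section

namespace DrinfeldWeil

/-! ### The exponential and the Anderson generating functions -/

section Analysis

variable {Fq : Type*} [Field Fq] [Fintype Fq]

lemma one_lt_card : 1 < Fintype.card Fq := Fintype.one_lt_card

instance : NonarchimedeanRing (CInf Fq) where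
  is_nonarchimedean := NonarchimedeanAddGroup.is_nonarchimedean

lemma frob_pow_apply (j : ℕ) (x : CInf Fq) :
    ((frob Fq) ^ j) x = x ^ Fintype.card Fq ^ j := by
  induction j with
  | zero => simp
  | succ j ih =>
    rw [pow_succ', AlgHom.mul_apply, ih, FiniteField.frobeniusAlgHom_apply, ← pow_mul, ← pow_succ]

lemma frob_toLinearMap_pow_apply (j : ℕ) (x : CInf Fq) :
    ((frob Fq).toLinearMap ^ j) x = x ^ Fintype.card Fq ^ j := by
  induction j with
  | zero => simp
  | succ j ih =>
    rw [pow_succ', Module.End.mul_apply, ih, AlgHom.toLinearMap_apply,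
      FiniteField.frobeniusAlgHom_apply, ← pow_mul, ← pow_succ]

variable {r : ℕ} (φ : DrinfeldModule Fq r)

namespace DrinfeldModule

lemma phiX_apply (x : CInf Fq) :
    φ.phiX x = ∑ i : Fin (r + 1), φ.g i * x ^ Fintype.card Fq ^ (i : ℕ) := by
  simp only [phiX, LinearMap.sum_apply, LinearMap.smul_apply, frob_toLinearMap_pow_apply,
    smul_eq_mul]

lemma continuous_phiX : Continuous φ.phiX := by
  have h : (φ.phiX : CInf Fq → CInf Fq) =
      fun x => ∑ i : Fin (r + 1), φ.g i * x ^ Fintype.card Fq ^ (i : ℕ) :=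
    funext φ.phiX_apply
  rw [h]
  fun_prop

lemma norm_theta_pow_sub_theta (i : ℕ) :
    (Fintype.card Fq : ℝ) ^ Fintype.card Fq ^ (i + 1) ≤
      ‖theta Fq ^ Fintype.card Fq ^ (i + 1) - theta Fq‖ := by
  have hq : (1 : ℝ) < Fintype.card Fq := by exact_mod_cast one_lt_card
  have h : ‖theta Fq‖ < ‖theta Fq ^ Fintype.card Fq ^ (i + 1)‖ := by
    rw [norm_pow, norm_theta]
    exact lt_self_pow₀ hq (Nat.one_lt_pow (by omega) one_lt_card)
  rw [sub_eq_add_neg, IsUltrametricDist.norm_add_eq_max_of_norm_ne_norm (by simpa using! h.ne'),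
    norm_neg, max_eq_left h.le, norm_pow, norm_theta]

/-- A radius on which `exp_φ` does not increase absolute values. Conjugating `φ` by a scalar of
this absolute value makes all coefficients `g_1, …, g_r` integral. -/
def expRadius : ℝ := (1 + ∑ j, ‖φ.g j‖)⁻¹

lemma one_le_radius_inv : 1 ≤ 1 + ∑ j, ‖φ.g j‖ :=
  le_add_of_nonneg_right (Finset.sum_nonneg fun _ _ => norm_nonneg _)

lemma expRadius_pos : 0 < φ.expRadius := inv_pos.mpr (one_pos.trans_le φ.one_le_radius_inv)

lemma expRadius_le_one : φ.expRadius ≤ 1 := inv_le_one_of_one_le₀ φ.one_le_radius_inv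

lemma norm_g_mul_expRadius_pow_le {j : Fin (r + 1)} {k : ℕ} (hk : k ≠ 0) :
    ‖φ.g j‖ * φ.expRadius ^ k ≤ 1 := by
  have h1 : φ.expRadius ^ k ≤ φ.expRadius :=
    pow_le_of_le_one φ.expRadius_pos.le φ.expRadius_le_one hk
  have h2 : ‖φ.g j‖ ≤ 1 + ∑ j, ‖φ.g j‖ :=
    (Finset.single_le_sum (f := fun j => ‖φ.g j‖) (fun _ _ => norm_nonneg _)
      (Finset.mem_univ j)).trans (le_add_of_nonneg_left zero_le_one)
  have hu := φ.expRadius_pos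
  calc ‖φ.g j‖ * φ.expRadius ^ k ≤ (1 + ∑ j, ‖φ.g j‖) * φ.expRadius := by
        gcongr
    _ = 1 := mul_inv_cancel₀ (one_pos.trans_le φ.one_le_radius_inv).ne'

/-- The rate in the decay `|e_i|^(1/q^i) = O(ρ^i)` of the coefficients of `exp_φ`; all that matters
is `0 ≤ ρ < 1` and `1 ≤ ρ^r q`. -/
def expRate (r : ℕ) : ℝ := 1 - (2 * r : ℝ)⁻¹

lemma expRate_nonneg (hr : 0 < r) : 0 ≤ expRate r := by
  have : (1 : ℝ) ≤ r := by exact_mod_cast hr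
  have : (2 * r : ℝ)⁻¹ ≤ 1 := inv_le_one_of_one_le₀ (by linarith)
  rw [expRate]; linarith

lemma expRate_lt_one (hr : 0 < r) : expRate r < 1 := by
  have : (0 : ℝ) < r := by exact_mod_cast hr
  have : 0 < (2 * r : ℝ)⁻¹ := by positivity
  rw [expRate]; linarith

lemma one_le_expRate_pow_mul {q : ℝ} (hr : 0 < r) (hq : 2 ≤ q) : 1 ≤ expRate r ^ r * q := by
  have hr' : (0 : ℝ) < r := by exact_mod_cast hr
  have h : 1 / 2 ≤ expRate r ^ r := by
    have h1 := one_add_mul_sub_le_pow (a := expRate r) (by linarith [expRate_nonneg hr]) r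
    have h2 : 1 + (r : ℝ) * (expRate r - 1) = 1 / 2 := by
      rw [expRate]; field_simp; ring
    linarith
  nlinarith

/-- The decay of the exponential coefficients. In the recursion the factor `q^(-q^i)` coming from
the denominator `θ^(q^i) - θ` pays for the loss of up to `r` powers of the rate. -/
lemma norm_expCoeff_mul_le (i : ℕ) : ‖φ.expCoeff i‖ * φ.expRadius ^ (Fintype.card Fq ^ i - 1) ≤
    (expRate r ^ i) ^ Fintype.card Fq ^ i := by
  set q := Fintype.card Fq with hqdef
  have hq : 1 < q := one_lt_card
  have hq2 : (2 : ℝ) ≤ q := by exact_mod_cast hq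
  have hr := φ.rank_pos
  have hρ0 := expRate_nonneg hr
  have hu := φ.expRadius_pos
  induction i using Nat.strong_induction_on with
  | _ i ih =>
  cases i with
  | zero => simp [expCoeff]
  | succ i =>
    have hB : 0 ≤ (expRate r ^ (i + 1)) ^ q ^ (i + 1) := by positivity
    have hq0 : (0 : ℝ) < q := by linarith
    rw [expCoeff, norm_mul, norm_inv]
    have hsum : ‖∑ j : Fin r, if (j : ℕ) ≤ i then
          φ.g j.succ * φ.expCoeff (i - j) ^ q ^ ((j : ℕ) + 1) else 0‖ *
          φ.expRadius ^ (q ^ (i + 1) - 1) ≤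
        (q : ℝ) ^ q ^ (i + 1) * (expRate r ^ (i + 1)) ^ q ^ (i + 1) := by
      rw [← le_div_iff₀ (by positivity)]
      refine IsUltrametricDist.norm_sum_le_of_forall_le_of_nonneg (by positivity) fun j _ => ?_
      rw [le_div_iff₀ (by positivity)]
      split_ifs with hj
      · have hexp : q ^ (i + 1) - 1 =
            (q ^ (i - j) - 1) * q ^ ((j : ℕ) + 1) + (q ^ ((j : ℕ) + 1) - 1) := by
          have h1 : q ^ (i - (j : ℕ)) * q ^ ((j : ℕ) + 1) = q ^ (i + 1) := by
            rw [← pow_add]; congr 1; omega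
          have h2 : 1 ≤ q ^ ((j : ℕ) + 1) := Nat.one_le_pow _ _ (by omega)
          have h3 : q ^ ((j : ℕ) + 1) ≤ q ^ (i + 1) := Nat.pow_le_pow_right (by omega) (by omega)
          rw [Nat.sub_mul, h1, one_mul]
          omega
        have hj0 : q ^ ((j : ℕ) + 1) - 1 ≠ 0 := by
          have := Nat.one_lt_pow (n := (j : ℕ) + 1) (by omega) hq
          omega
        have hpow : ((expRate r ^ (i - j)) ^ q ^ (i - (j : ℕ))) ^ q ^ ((j : ℕ) + 1) =
            (expRate r ^ (i - j)) ^ q ^ (i + 1) := by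
          rw [← pow_mul, ← pow_add]; congr 2; omega
        calc ‖φ.g j.succ * φ.expCoeff (i - j) ^ q ^ ((j : ℕ) + 1)‖ *
              φ.expRadius ^ (q ^ (i + 1) - 1)
            = (‖φ.g j.succ‖ * φ.expRadius ^ (q ^ ((j : ℕ) + 1) - 1)) *
              (‖φ.expCoeff (i - j)‖ * φ.expRadius ^ (q ^ (i - j) - 1)) ^ q ^ ((j : ℕ) + 1) := by
              rw [hexp, pow_add φ.expRadius, pow_mul φ.expRadius, norm_mul, norm_pow, mul_pow]
              generalize φ.expRadius ^ (q ^ ((j : ℕ) + 1) - 1) = A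
              generalize (φ.expRadius ^ (q ^ (i - (j : ℕ)) - 1)) ^ q ^ ((j : ℕ) + 1) = B
              ring
          _ ≤ 1 * ((expRate r ^ (i - j)) ^ q ^ (i - (j : ℕ))) ^ q ^ ((j : ℕ) + 1) := by
              gcongr
              · exact φ.norm_g_mul_expRadius_pow_le hj0
              · exact ih _ (by omega)
          _ = (1 * expRate r ^ (i - j)) ^ q ^ (i + 1) := by rw [one_mul, one_mul, hpow]
          _ ≤ ((expRate r ^ r * q) * expRate r ^ (i - j)) ^ q ^ (i + 1) := by
              gcongr
              exact one_le_expRate_pow_mul hr hq2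
          _ = (q * expRate r ^ (r + (i - j))) ^ q ^ (i + 1) := by ring
          _ ≤ (q * expRate r ^ (i + 1)) ^ q ^ (i + 1) := by
              have : expRate r ^ (r + (i - j)) ≤ expRate r ^ (i + 1) :=
                pow_le_pow_of_le_one hρ0 (expRate_lt_one hr).le (by omega)
              gcongr
          _ = _ := mul_pow _ _ _
      · rw [norm_zero, zero_mul]; positivity
    rw [mul_assoc]
    have hden := norm_theta_pow_sub_theta (Fq := Fq) i
    rw [← hqdef] at hden
    have hqp : (0 : ℝ) < (q : ℝ) ^ q ^ (i + 1) := by positivity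
    rw [inv_mul_le_iff₀ (hqp.trans_le hden)]
    exact hsum.trans (by gcongr)

lemma norm_expCoeff_mul_pow_le (i : ℕ) (μ : CInf Fq) :
    ‖φ.expCoeff i * μ ^ Fintype.card Fq ^ i‖ ≤
      φ.expRadius * (expRate r ^ i * (‖μ‖ / φ.expRadius)) ^ Fintype.card Fq ^ i := by
  have hu := φ.expRadius_pos
  have h1 : φ.expRadius ^ Fintype.card Fq ^ i =
      φ.expRadius * φ.expRadius ^ (Fintype.card Fq ^ i - 1) := by
    rw [← pow_succ', Nat.sub_add_cancel (Nat.one_le_pow _ _ Fintype.card_pos)]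
  calc ‖φ.expCoeff i * μ ^ Fintype.card Fq ^ i‖
      = φ.expRadius * (‖φ.expCoeff i‖ * φ.expRadius ^ (Fintype.card Fq ^ i - 1)) *
          (‖μ‖ / φ.expRadius) ^ Fintype.card Fq ^ i := by
        rw [norm_mul, norm_pow, div_pow, h1]; field_simp
    _ ≤ φ.expRadius * (expRate r ^ i) ^ Fintype.card Fq ^ i *
          (‖μ‖ / φ.expRadius) ^ Fintype.card Fq ^ i := by
        gcongr
        exact φ.norm_expCoeff_mul_le i
    _ = _ := by rw [mul_pow]; ring

lemma summable_exp (μ : CInf Fq) :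
    Summable fun i => φ.expCoeff i * μ ^ Fintype.card Fq ^ i := by
  have hu := φ.expRadius_pos
  have hρ0 := expRate_nonneg φ.rank_pos
  have h0 : Filter.Tendsto (fun i => expRate r ^ i * (‖μ‖ / φ.expRadius)) Filter.atTop
      (nhds 0) := by
    simpa using (tendsto_pow_atTop_nhds_zero_of_lt_one hρ0
      (expRate_lt_one φ.rank_pos)).mul_const (‖μ‖ / φ.expRadius)
  refine Summable.of_norm_bounded_eventually_nat
    (g := fun i => φ.expRadius * (1 / 2 : ℝ) ^ i) (summable_geometric_two.mul_left _) ?_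
  filter_upwards [h0.eventually_le_const (show (0 : ℝ) < 1 / 2 by norm_num)] with i hi
  refine (φ.norm_expCoeff_mul_pow_le i μ).trans ?_
  gcongr
  calc (expRate r ^ i * (‖μ‖ / φ.expRadius)) ^ Fintype.card Fq ^ i
      ≤ (1 / 2 : ℝ) ^ Fintype.card Fq ^ i := by gcongr
    _ ≤ (1 / 2 : ℝ) ^ i := pow_le_pow_of_le_one (by norm_num) (by norm_num)
        (Nat.lt_pow_self one_lt_card).le

lemma norm_exp_le {μ : CInf Fq} (hμ : ‖μ‖ ≤ φ.expRadius) : ‖φ.exp μ‖ ≤ ‖μ‖ := by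
  have hu := φ.expRadius_pos
  have hρ0 := expRate_nonneg φ.rank_pos
  have hd : ‖μ‖ / φ.expRadius ≤ 1 := (div_le_one hu).mpr hμ
  have hd0 : 0 ≤ ‖μ‖ / φ.expRadius := by positivity
  refine le_of_tendsto (φ.summable_exp μ).hasSum.norm (Filter.Eventually.of_forall fun s => ?_)
  refine IsUltrametricDist.norm_sum_le_of_forall_le_of_nonneg (norm_nonneg _) fun i _ => ?_
  refine (φ.norm_expCoeff_mul_pow_le i μ).trans ?_
  calc φ.expRadius * (expRate r ^ i * (‖μ‖ / φ.expRadius)) ^ Fintype.card Fq ^ i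
      ≤ φ.expRadius * (1 * (‖μ‖ / φ.expRadius)) ^ Fintype.card Fq ^ i := by
        gcongr
        exact pow_le_one₀ hρ0 (expRate_lt_one φ.rank_pos).le
    _ ≤ φ.expRadius * (‖μ‖ / φ.expRadius) := by
        rw [one_mul]
        gcongr
        exact pow_le_of_le_one hd0 hd (pow_ne_zero _ Fintype.card_ne_zero)
    _ = ‖μ‖ := by field_simp

/-- The functional equation of the exponential, deduced from that of its coefficients. -/
lemma phiX_exp (μ : CInf Fq) : φ.phiX (φ.exp μ) = φ.exp (theta Fq * μ) := by
  set q := Fintype.card Fq with hqdef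
  -- the `j`-th summand of `φ_x (exp μ)`, with its terms moved up by `j` places
  let F : ℕ → ℕ → CInf Fq := fun j i => if j ≤ i then
    (φ.expCoeff (i - j) * μ ^ q ^ (i - j)) ^ q ^ j else 0
  have hF : ∀ j, HasSum (F j) (φ.exp μ ^ q ^ j) := by
    intro j
    have h1 : HasSum (fun k => (φ.expCoeff k * μ ^ q ^ k) ^ q ^ j) (φ.exp μ ^ q ^ j) := by
      have := (φ.summable_exp μ).hasSum.map ((frob Fq) ^ j) (by
        simp only [funext (frob_pow_apply (Fq := Fq) j)]
        fun_prop)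
      simpa only [Function.comp_def, frob_pow_apply] using! this
    have h2 : Function.Injective fun k : ℕ => k + j := add_left_injective j
    rw [← h2.hasSum_iff]
    · simpa [F, Function.comp_def] using h1
    · intro i hi
      have : ¬ j ≤ i := fun h => hi ⟨i - j, Nat.sub_add_cancel h⟩
      simp [F, this]
  have hS : HasSum (fun i => ∑ j : Fin (r + 1), φ.g j * F j i) (φ.phiX (φ.exp μ)) := by
    rw [phiX_apply]
    exact hasSum_sum fun j _ => (hF j).mul_left _
  rw [← hS.tsum_eq, exp]
  congr 1
  funext i
  rw [mul_pow, ← mul_assoc, φ.expCoeff_spec, Finset.sum_mul]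
  refine Finset.sum_congr rfl fun j _ => ?_
  by_cases hj : (j : ℕ) ≤ i
  · simp only [F, hj, if_true]
    rw [mul_pow, ← pow_mul, ← pow_add, Nat.sub_add_cancel hj]
    ring
  · simp [F, hj]

lemma theta_ne_zero : theta Fq ≠ 0 := by
  rw [← norm_ne_zero_iff, norm_theta]
  exact_mod_cast Fintype.card_ne_zero

lemma omega_mem_tateAlgebra (z : CInf Fq) : φ.omega z ∈ tateAlgebra Fq := by
  have hq : (1 : ℝ) < Fintype.card Fq := by exact_mod_cast one_lt_card
  have h0 : Filter.Tendsto (fun k : ℕ => ‖z / theta Fq ^ (k + 1)‖) Filter.atTop (nhds 0) := by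
    have h := ((tendsto_inv_atTop_zero.comp (tendsto_pow_atTop_atTop_of_one_lt hq)).comp
      (Filter.tendsto_add_atTop_nat 1)).const_mul ‖z‖
    simpa [Function.comp_def, norm_div, norm_theta, div_eq_mul_inv] using h
  rw [mem_tateAlgebra]
  refine squeeze_zero' (Filter.Eventually.of_forall fun _ => norm_nonneg _) ?_ h0
  filter_upwards [h0.eventually_le_const φ.expRadius_pos] with k hk
  simpa [omega] using φ.norm_exp_le hk

/-- The functional equation `φ_x(ω_z) = t ω_z` of the Anderson generating function of a period. -/
lemma phiX_coeff_omega {z : CInf Fq} (hz : z ∈ φ.lattice) (k : ℕ) :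
    φ.phiX (PowerSeries.coeff k (φ.omega z)) = PowerSeries.coeff k (PowerSeries.X * φ.omega z) := by
  have hθ := theta_ne_zero (Fq := Fq)
  cases k with
  | zero =>
    have hz' : φ.exp z = 0 := hz
    rw [PowerSeries.coeff_zero_X_mul, omega, PowerSeries.coeff_mk, phiX_exp, ← hz']
    congr 1
    field_simp
    ring
  | succ k =>
    rw [PowerSeries.coeff_succ_X_mul, omega, PowerSeries.coeff_mk, PowerSeries.coeff_mk, phiX_exp]
    congr 1
    field_simp
    ring

end DrinfeldModule

end Analysis

/-! ### Polynomials modulo `𝔣` -/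

section Polynomials

variable {Fq : Type*} [Field Fq]

lemma coeff_X_pow_modByMonic {f : Fq[X]} (hf : f.Monic) (i : ℕ) {j : ℕ} (hj : f.natDegree ≤ j) :
    (X ^ i %ₘ f).coeff j = 0 :=
  coeff_eq_zero_of_degree_lt ((degree_modByMonic_lt _ hf).trans_le
    (degree_le_natDegree.trans (by exact_mod_cast hj)))

lemma X_pow_add_modByMonic {f : Fq[X]} (hf : f.Monic) (a b : ℕ) :
    X ^ (a + b) %ₘ f = ∑ k ∈ Finset.range f.natDegree, ∑ l ∈ Finset.range f.natDegree,
      ((X ^ a %ₘ f).coeff k * (X ^ b %ₘ f).coeff l) • (X ^ (k + l) %ₘ f) := by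
  have h : ∀ m, X ^ m %ₘ f =
      ∑ k ∈ Finset.range f.natDegree, (X ^ m %ₘ f).coeff k • (X : Fq[X]) ^ k := by
    intro m
    by_cases hn : 0 < f.natDegree
    · have hlt : (X ^ m %ₘ f).natDegree < f.natDegree :=
        natDegree_modByMonic_lt _ hf (by rintro rfl; simp at hn)
      conv_lhs => rw [as_sum_range' _ _ hlt]
      simp only [← C_mul_X_pow_eq_monomial, smul_eq_C_mul]
    · have hf1 : f = 1 := hf.natDegree_eq_zero.mp (by omega)
      simp [hf1]
  have h2 : (X ^ a %ₘ f) * (X ^ b %ₘ f) =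
      ∑ k ∈ Finset.range f.natDegree, ∑ l ∈ Finset.range f.natDegree,
        ((X ^ a %ₘ f).coeff k * (X ^ b %ₘ f).coeff l) • (X : Fq[X]) ^ (k + l) := by
    conv_lhs => rw [h a, h b, Finset.sum_mul_sum]
    simp only [smul_mul_smul_comm, ← pow_add]
  have h3 : X ^ (a + b) %ₘ f = ((X ^ a %ₘ f) * (X ^ b %ₘ f)) %ₘ f := by
    rw [pow_add, mul_modByMonic]
  rw [h3, h2, ← modByMonicHom_apply, map_sum]
  simp only [map_sum, map_smul, modByMonicHom_apply]

lemma dualPoly_succ (f : Fq[X]) {i : ℕ} (hi : i < f.natDegree) :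
    dualPoly f i = X * dualPoly f (i + 1) + C (f.coeff (i + 1)) := by
  obtain ⟨m, hm⟩ : ∃ m, f.natDegree - i = m + 1 := ⟨f.natDegree - i - 1, by omega⟩
  have hm' : f.natDegree - (i + 1) = m := by omega
  rw [dualPoly, dualPoly, hm, hm', Finset.sum_range_succ', Finset.mul_sum]
  congr 1
  · refine Finset.sum_congr rfl fun j _ => ?_
    rw [show i + (j + 1) + 1 = i + 1 + j + 1 by omega]
    ring
  · simp

lemma X_mul_dualPoly_zero_add (f : Fq[X]) : X * dualPoly f 0 + C (f.coeff 0) = f := by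
  conv_rhs => rw [as_sum_range_C_mul_X_pow f, Finset.sum_range_succ']
  rw [dualPoly, Finset.mul_sum, Nat.sub_zero]
  congr 1
  · refine Finset.sum_congr rfl fun j _ => ?_
    rw [zero_add]
    ring
  · simp

end Polynomials

/-! ### Remainders of restricted power series -/

section Remainder

variable {Fq : Type*} [Field Fq] [Fintype Fq]

local notation "ι" => algebraMap Fq (CInf Fq)

lemma norm_algebraMap_le_one (a : Fq) : ‖ι a‖ ≤ 1 := by
  by_contra! h
  have h1 : ‖ι a‖ ^ Fintype.card Fq = ‖ι a‖ := by
    rw [← norm_pow, ← map_pow, FiniteField.pow_card]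
  exact (lt_self_pow₀ h one_lt_card).ne' h1

lemma summable_tateAlgebra_coeff_mul {ω : (CInf Fq)⟦X⟧} (hω : ω ∈ tateAlgebra Fq) (s : ℕ → Fq) :
    Summable fun i => PowerSeries.coeff i ω * ι (s i) := by
  refine NonarchimedeanAddGroup.summable_of_tendsto_cofinite_zero ?_
  rw [Nat.cofinite_eq_atTop, tendsto_zero_iff_norm_tendsto_zero]
  refine squeeze_zero (fun _ => norm_nonneg _) (fun i => ?_) ((mem_tateAlgebra Fq ω).mp hω)
  rw [norm_mul]
  exact mul_le_of_le_one_right (norm_nonneg _) (norm_algebraMap_le_one _)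

/-- The coefficients of the remainder are given by one formula in all degrees, including those
degrees `≥ deg f` where they vanish. -/
lemma coeff_remainder {f : Fq[X]} (hf : f.Monic) (ω : (CInf Fq)⟦X⟧) (j : ℕ) :
    (remainder f ω).coeff j =
      ∑' i, PowerSeries.coeff i ω * ι ((X ^ i %ₘ f).coeff j) := by
  rw [remainder, finsetSum_coeff]
  simp only [coeff_monomial, Finset.sum_ite_eq', Finset.mem_range]
  split_ifs with hj
  · rfl
  · simp [coeff_X_pow_modByMonic hf _ (not_lt.mp hj)]

lemma hasSum_coeff_remainder {f : Fq[X]} (hf : f.Monic) {ω : (CInf Fq)⟦X⟧}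
    (hω : ω ∈ tateAlgebra Fq) (j : ℕ) :
    HasSum (fun i => PowerSeries.coeff i ω * ι ((X ^ i %ₘ f).coeff j))
      ((remainder f ω).coeff j) := by
  rw [coeff_remainder hf]
  exact (summable_tateAlgebra_coeff_mul hω _).hasSum

lemma coeff_remainder_of_le (f : Fq[X]) (ω : (CInf Fq)⟦X⟧) {j : ℕ} (hj : f.natDegree ≤ j) :
    (remainder f ω).coeff j = 0 := by
  rw [remainder, finsetSum_coeff]
  simp only [coeff_monomial, Finset.sum_ite_eq', Finset.mem_range, hj.not_gt, if_false]

lemma remainder_eq_sum (f : Fq[X]) (ω : (CInf Fq)⟦X⟧) : remainder f ω =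
    ∑ k ∈ Finset.range f.natDegree, C ((remainder f ω).coeff k) * X ^ k := by
  ext j
  simp only [finsetSum_coeff, coeff_C_mul_X_pow, Finset.sum_ite_eq, Finset.mem_range]
  split_ifs with hj
  · rfl
  · exact coeff_remainder_of_le f ω (not_lt.mp hj)

lemma remainder_X_pow {f : Fq[X]} (hf : f.Monic) (m : ℕ) :
    remainder f (PowerSeries.X ^ m) = (X ^ m %ₘ f).map ι := by
  ext j
  rw [coeff_remainder hf, tsum_eq_single m]
  · simp
  · intro i hi
    simp [PowerSeries.coeff_X_pow, hi]

lemma map_dvd_X_pow_sub {f : Fq[X]} (m : ℕ) :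
    f.map ι ∣ X ^ m - (X ^ m %ₘ f).map ι := by
  refine ⟨(X ^ m /ₘ f).map ι, ?_⟩
  conv_lhs => rw [modByMonic_eq_sub_mul_div]
  simp

/-- The evaluation at `t̄` is multiplicative: a double series indexed by pairs `(a, b)` is summed
once as a product and once along `a + b = i`. -/
lemma coeff_remainder_mul {f : Fq[X]} (hf : f.Monic) {ω η : (CInf Fq)⟦X⟧}
    (hω : ω ∈ tateAlgebra Fq) (hη : η ∈ tateAlgebra Fq) (j : ℕ) :
    (remainder f (ω * η)).coeff j =
      ∑ k ∈ Finset.range f.natDegree, ∑ l ∈ Finset.range f.natDegree,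
        (remainder f ω).coeff k * (remainder f η).coeff l * ι ((X ^ (k + l) %ₘ f).coeff j) := by
  have h1 : HasSum (fun p : ℕ × ℕ => PowerSeries.coeff p.1 ω * PowerSeries.coeff p.2 η *
      ι ((X ^ (p.1 + p.2) %ₘ f).coeff j))
      (∑ k ∈ Finset.range f.natDegree, ∑ l ∈ Finset.range f.natDegree,
        (remainder f ω).coeff k * (remainder f η).coeff l * ι ((X ^ (k + l) %ₘ f).coeff j)) := by
    have h2 := hasSum_sum (s := Finset.range f.natDegree) fun k _ =>
      hasSum_sum (s := Finset.range f.natDegree) fun l _ =>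
        ((hasSum_coeff_remainder hf hω k).mul_of_nonarchimedean
          (hasSum_coeff_remainder hf hη l)).mul_right (ι ((X ^ (k + l) %ₘ f).coeff j))
    refine h2.congr_fun ?_
    rintro ⟨a, b⟩
    simp only [X_pow_add_modByMonic hf a b, finsetSum_coeff, coeff_smul, smul_eq_mul, map_sum,
      map_mul, Finset.mul_sum]
    exact Finset.sum_congr rfl fun k _ => Finset.sum_congr rfl fun l _ => by ring
  rw [coeff_remainder hf]
  rw [← Finset.HasAntidiagonal.sigmaAntidiagonalEquivProd.hasSum_iff] at h1
  refine (h1.sigma fun i => ?_).tsum_eq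
  have h3 : PowerSeries.coeff i (ω * η) * ι ((X ^ i %ₘ f).coeff j) =
      ∑ c : Finset.HasAntidiagonal.antidiagonal i, PowerSeries.coeff (c : ℕ × ℕ).1 ω *
        PowerSeries.coeff (c : ℕ × ℕ).2 η * ι ((X ^ i %ₘ f).coeff j) := by
    rw [PowerSeries.coeff_mul, Finset.sum_mul, ← Finset.sum_finset_coe]
    rfl
  rw [h3]
  refine (hasSum_fintype _).congr_fun ?_
  rintro ⟨⟨a, b⟩, hab⟩
  simp [Finset.HasAntidiagonal.mem_antidiagonal.mp hab]

lemma map_dvd_remainder_mul_sub {f : Fq[X]} (hf : f.Monic) {ω η : (CInf Fq)⟦X⟧}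
    (hω : ω ∈ tateAlgebra Fq) (hη : η ∈ tateAlgebra Fq) :
    f.map ι ∣ remainder f ω * remainder f η - remainder f (ω * η) := by
  have h1 : remainder f (ω * η) =
      ∑ k ∈ Finset.range f.natDegree, ∑ l ∈ Finset.range f.natDegree,
        C ((remainder f ω).coeff k * (remainder f η).coeff l) * (X ^ (k + l) %ₘ f).map ι := by
    ext j
    simp only [coeff_remainder_mul hf hω hη, finsetSum_coeff, coeff_C_mul, coeff_map]
  have h2 : remainder f ω * remainder f η =
      ∑ k ∈ Finset.range f.natDegree, ∑ l ∈ Finset.range f.natDegree,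
        C ((remainder f ω).coeff k * (remainder f η).coeff l) * X ^ (k + l) := by
    conv_lhs => rw [remainder_eq_sum f ω, remainder_eq_sum f η, Finset.sum_mul_sum]
    refine Finset.sum_congr rfl fun k _ => Finset.sum_congr rfl fun l _ => ?_
    rw [C_mul]; ring
  rw [h1, h2, ← Finset.sum_sub_distrib]
  refine Finset.dvd_sum fun k _ => ?_
  rw [← Finset.sum_sub_distrib]
  refine Finset.dvd_sum fun l _ => ?_
  rw [← mul_sub]
  exact (map_dvd_X_pow_sub _).mul_left _

lemma mk_eq_mk_iff_map_dvd {f : Fq[X]} {P Q : (CInf Fq)[X]} :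
    Ideal.Quotient.mk (Ideal.span {f.map ι}) P = Ideal.Quotient.mk (Ideal.span {f.map ι}) Q ↔
      f.map ι ∣ P - Q := by
  rw [Ideal.Quotient.mk_eq_mk_iff_sub_mem, Ideal.mem_span_singleton]

/-- The evaluation `ω ↦ ω(t̄)` from the Tate algebra to `ℂ_∞[t] / 𝔣`. -/
def evalQuotient {f : Fq[X]} (hf : f.Monic) :
    tateAlgebra Fq →+* (CInf Fq)[X] ⧸ Ideal.span {f.map ι} where
  toFun ω := Ideal.Quotient.mk _ (remainder f ω)
  map_one' := by
    have h := remainder_X_pow (Fq := Fq) hf 0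
    rw [pow_zero, pow_zero] at h
    rw [Subring.coe_one, h, eq_comm, ← map_one (Ideal.Quotient.mk _), mk_eq_mk_iff_map_dvd]
    simpa using map_dvd_X_pow_sub (Fq := Fq) (f := f) 0
  map_mul' ω η := by
    rw [Subring.coe_mul, eq_comm, ← map_mul, mk_eq_mk_iff_map_dvd]
    exact map_dvd_remainder_mul_sub hf ω.2 η.2
  map_zero' := by
    have : remainder f (0 : (CInf Fq)⟦X⟧) = 0 := by ext j; simp [coeff_remainder hf]
    rw [Subring.coe_zero, this, map_zero]
  map_add' ω η := by
    rw [← map_add]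
    congr 1
    ext j
    rw [coeff_add, coeff_remainder hf, coeff_remainder hf, coeff_remainder hf,
      ← (summable_tateAlgebra_coeff_mul ω.2 _).tsum_add (summable_tateAlgebra_coeff_mul η.2 _)]
    simp [add_mul]

/-- Polynomials of degree `< deg 𝔣` are determined by their classes modulo `𝔣`. -/
lemma eq_of_map_dvd_sub {f : Fq[X]} (hf : f.Monic) {P Q : (CInf Fq)[X]}
    (hP : ∀ j, f.natDegree ≤ j → P.coeff j = 0) (hQ : ∀ j, f.natDegree ≤ j → Q.coeff j = 0)
    (h : f.map ι ∣ P - Q) : P = Q := by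
  refine sub_eq_zero.mp (eq_zero_of_dvd_of_degree_lt h ?_)
  rw [degree_map, degree_eq_natDegree hf.ne_zero, degree_lt_iff_coeff_zero]
  intro m hm
  rw [coeff_sub, hP m hm, hQ m hm, sub_zero]

lemma X_mem_tateAlgebra : (PowerSeries.X : (CInf Fq)⟦X⟧) ∈ tateAlgebra Fq := by
  rw [mem_tateAlgebra]
  refine tendsto_const_nhds.congr' ?_
  filter_upwards [Filter.eventually_gt_atTop 1] with i hi
  simp [PowerSeries.coeff_X, hi.ne']

/-- The remainder of `t ω`: multiply the remainder of `ω` by `t` and reduce the top coefficient. -/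
lemma remainder_X_mul {f : Fq[X]} (hf : f.Monic) (hn : 0 < f.natDegree) {ω : (CInf Fq)⟦X⟧}
    (hω : ω ∈ tateAlgebra Fq) : remainder f (PowerSeries.X * ω) =
      X * remainder f ω - C ((remainder f ω).coeff (f.natDegree - 1)) * f.map ι := by
  refine eq_of_map_dvd_sub hf (fun j hj => coeff_remainder_of_le f _ hj) (fun j hj => ?_) ?_
  · obtain ⟨j, rfl⟩ := Nat.exists_eq_succ_of_ne_zero (by omega : j ≠ 0)
    rw [coeff_sub, coeff_X_mul, coeff_C_mul, coeff_map]
    obtain h | h := hj.eq_or_lt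
    · have h' : f.natDegree - 1 = j := by omega
      rw [← h, hf.coeff_natDegree, h', map_one, mul_one, sub_self]
    · rw [coeff_eq_zero_of_natDegree_lt h, coeff_remainder_of_le f _ (by omega), map_zero,
        mul_zero, sub_zero]
  · have h1 := map_dvd_remainder_mul_sub hf X_mem_tateAlgebra hω
    have h2 : f.map ι ∣ X - remainder f (PowerSeries.X : (CInf Fq)⟦X⟧) := by
      have h3 := remainder_X_pow (Fq := Fq) hf 1
      rw [pow_one, pow_one] at h3
      rw [h3]
      simpa using map_dvd_X_pow_sub (Fq := Fq) (f := f) 1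
    have h4 : remainder f (PowerSeries.X * ω) - (X * remainder f ω -
        C ((remainder f ω).coeff (f.natDegree - 1)) * f.map ι) =
        C ((remainder f ω).coeff (f.natDegree - 1)) * f.map ι -
        (X - remainder f (PowerSeries.X : (CInf Fq)⟦X⟧)) * remainder f ω -
        (remainder f (PowerSeries.X : (CInf Fq)⟦X⟧) * remainder f ω -
          remainder f (PowerSeries.X * ω)) := by ring
    rw [h4]
    exact dvd_sub (dvd_sub (dvd_mul_left _ _) (h2.mul_right _)) h1

lemma twistPowerSeries_mem_tateAlgebra {ω : (CInf Fq)⟦X⟧} (hω : ω ∈ tateAlgebra Fq) :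
    twistPowerSeries Fq ω ∈ tateAlgebra Fq := by
  rw [mem_tateAlgebra] at hω ⊢
  have h := hω.pow (Fintype.card Fq)
  rw [zero_pow Fintype.card_ne_zero] at h
  refine h.congr fun i => ?_
  simp [twistPowerSeries, PowerSeries.mapAlgHom_apply]

/-- A continuous `𝔽_q`-linear operator on `ℂ_∞`, applied coefficientwise, commutes with taking
remainders. -/
lemma hasSum_map_coeff_remainder {f : Fq[X]} (hf : f.Monic) {ω : (CInf Fq)⟦X⟧}
    (hω : ω ∈ tateAlgebra Fq) (L : Module.End Fq (CInf Fq)) (hL : Continuous L) (j : ℕ) :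
    HasSum (fun i => L (PowerSeries.coeff i ω) * ι ((X ^ i %ₘ f).coeff j))
      (L ((remainder f ω).coeff j)) := by
  have h := (hasSum_coeff_remainder hf hω j).map L hL
  refine h.congr_fun fun i => ?_
  rw [Function.comp_apply, mul_comm, mul_comm (PowerSeries.coeff i ω), ← Algebra.smul_def,
    ← Algebra.smul_def, map_smul]

lemma twistPoly_remainder {f : Fq[X]} (hf : f.Monic) {ω : (CInf Fq)⟦X⟧}
    (hω : ω ∈ tateAlgebra Fq) :
    twistPoly Fq (remainder f ω) = remainder f (twistPowerSeries Fq ω) := by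
  ext j
  have hc : Continuous (frob Fq).toLinearMap := by
    have : ((frob Fq).toLinearMap : CInf Fq → CInf Fq) = fun x => x ^ Fintype.card Fq := by
      ext x; simp
    rw [this]; fun_prop
  rw [coeff_remainder hf]
  refine Eq.trans ?_ (hasSum_map_coeff_remainder hf hω _ hc j).tsum_eq.symm
  simp [twistPoly]

namespace DrinfeldModule

variable {r : ℕ} (φ : DrinfeldModule Fq r)

lemma phiX_coeff_remainder {f : Fq[X]} (hf : f.Monic) (hn : 0 < f.natDegree)
    {ω : (CInf Fq)⟦X⟧} (hω : ω ∈ tateAlgebra Fq)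
    (h : ∀ k, φ.phiX (PowerSeries.coeff k ω) = PowerSeries.coeff k (PowerSeries.X * ω)) (j : ℕ) :
    φ.phiX ((remainder f ω).coeff j) = (X * remainder f ω).coeff j -
      f.coeff j • (remainder f ω).coeff (f.natDegree - 1) := by
  rw [← (hasSum_map_coeff_remainder hf hω φ.phiX φ.continuous_phiX j).tsum_eq]
  simp only [h]
  rw [← coeff_remainder hf, remainder_X_mul hf hn hω, coeff_sub, coeff_C_mul, coeff_map,
    mul_comm (coeff _ _), Algebra.smul_def]

lemma phi_X_mul_add_C (p : Fq[X]) (a : Fq) (x : CInf Fq) :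
    φ.phi (X * p + C a) x = φ.phiX (φ.phi p x) + a • x := by
  simp [phi]

/-- All coefficients of the remainder of an eigenfunction `ω` (that is, `φ_x(ω) = t ω`) are
determined by the last one. -/
lemma coeff_remainder_eq_phi_dualPoly {f : Fq[X]} (hf : f.Monic) (hn : 0 < f.natDegree)
    {ω : (CInf Fq)⟦X⟧} (hω : ω ∈ tateAlgebra Fq)
    (h : ∀ k, φ.phiX (PowerSeries.coeff k ω) = PowerSeries.coeff k (PowerSeries.X * ω))
    {j : ℕ} (hj : j ≤ f.natDegree) :
    (remainder f ω).coeff j = φ.phi (dualPoly f j) ((remainder f ω).coeff (f.natDegree - 1)) := by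
  induction hj using Nat.decreasingInduction with
  | self => rw [coeff_remainder_of_le f ω le_rfl]; simp [dualPoly]
  | of_succ j hj ih =>
    rw [dualPoly_succ f hj, phi_X_mul_add_C, ← ih, φ.phiX_coeff_remainder hf hn hω h, coeff_X_mul,
      sub_add_cancel]

/-- The constant coefficient closes the recursion that expresses the coefficients of the remainder
through the top one, and this says that the top one is a torsion point. -/
lemma coeff_remainder_mem_torsion {f : Fq[X]} (hf : f.Monic) (hn : 0 < f.natDegree)
    {ω : (CInf Fq)⟦X⟧} (hω : ω ∈ tateAlgebra Fq)
    (h : ∀ k, φ.phiX (PowerSeries.coeff k ω) = PowerSeries.coeff k (PowerSeries.X * ω)) :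
    (remainder f ω).coeff (f.natDegree - 1) ∈ φ.torsion f := by
  have h0 := φ.phi_X_mul_add_C (dualPoly f 0) (f.coeff 0)
    ((remainder f ω).coeff (f.natDegree - 1))
  rw [X_mul_dualPoly_zero_add] at h0
  rw [torsion, LinearMap.mem_ker, h0, ← φ.coeff_remainder_eq_phi_dualPoly hf hn hω h
    (Nat.zero_le _), φ.phiX_coeff_remainder hf hn hω h, mul_coeff_zero, coeff_X_zero, zero_mul, zero_sub,
    neg_add_cancel]

end DrinfeldModule

end Remainder

/-! ### Polynomials acting on tensors -/

section TensorAction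

variable {R V : Type*} [CommRing R] [AddCommGroup V] [Module R V] {r : ℕ}

/-- The action of polynomials on `μ_1 ⊗ ⋯ ⊗ μ_r` for which the variable `X_i` acts by the
endomorphism `α` in the `i`-th factor. -/
def tensorAction (α : Module.End R V) (μ : Fin r → V) :
    MvPolynomial (Fin r) R →ₗ[R] ⨂[R] _ : Fin r, V :=
  (MvPolynomial.basisMonomials (Fin r) R).constr R fun a =>
    PiTensorProduct.tprod R fun i => (α ^ a i) (μ i)

lemma tensorAction_apply (α : Module.End R V) (μ : Fin r → V) (F : MvPolynomial (Fin r) R) :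
    tensorAction α μ F = ∑ a ∈ F.support,
      F.coeff a • PiTensorProduct.tprod R fun i => (α ^ a i) (μ i) := by
  rw [tensorAction, Module.Basis.constr_apply]
  rfl

lemma tensorAction_monomial (α : Module.End R V) (μ : Fin r → V) (a : Fin r →₀ ℕ) (c : R) :
    tensorAction α μ (MvPolynomial.monomial a c) =
      c • PiTensorProduct.tprod R fun i => (α ^ a i) (μ i) := by
  have h : MvPolynomial.monomial a c = c • MvPolynomial.basisMonomials (Fin r) R a := by
    simp [MvPolynomial.smul_monomial]
  rw [h, map_smul, tensorAction, Module.Basis.constr_basis]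

lemma tensorAction_prod (α : Module.End R V) (μ : Fin r → V) (p : Fin r → R[X]) :
    tensorAction α μ (∏ i, aeval (MvPolynomial.X i) (p i)) =
      PiTensorProduct.tprod R fun i => aeval α (p i) (μ i) := by
  let A : MultilinearMap R (fun _ : Fin r => R[X]) (⨂[R] _ : Fin r, V) :=
    (tensorAction α μ).compMultilinearMap
      ((MultilinearMap.mkPiAlgebra R (Fin r) (MvPolynomial (Fin r) R)).compLinearMap fun i =>
        (aeval (MvPolynomial.X i : MvPolynomial (Fin r) R)).toLinearMap)
  let B : MultilinearMap R (fun _ : Fin r => R[X]) (⨂[R] _ : Fin r, V) :=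
    (PiTensorProduct.tprod R).compLinearMap fun i =>
      (LinearMap.applyₗ (μ i)).comp (aeval α).toLinearMap
  suffices h : A = B from congrArg (fun M => M p) h
  refine Module.Basis.ext_multilinear (fun _ => Polynomial.basisMonomials R) fun a => ?_
  have h1 : ∏ i : Fin r, (MvPolynomial.X i : MvPolynomial (Fin r) R) ^ a i =
      MvPolynomial.basisMonomials (Fin r) R (Finsupp.equivFunOnFinite.symm a) := by
    simp [MvPolynomial.monomial_eq, Finsupp.prod_fintype]
  simp only [A, B, LinearMap.compMultilinearMap_apply, MultilinearMap.compLinearMap_apply,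
    MultilinearMap.mkPiAlgebra_apply, Polynomial.coe_basisMonomials,
    ← Polynomial.X_pow_eq_monomial, AlgHom.toLinearMap_apply, map_pow, aeval_X, h1, tensorAction,
    Module.Basis.constr_basis, LinearMap.comp_apply, LinearMap.applyₗ_apply_apply,
    Finsupp.equivFunOnFinite_symm_apply_apply]

lemma tensorAction_mul_eq_zero (α : Module.End R V) (μ : Fin r → V) (i : Fin r) {f : R[X]}
    (hf : aeval α f (μ i) = 0) (F : MvPolynomial (Fin r) R) :
    tensorAction α μ (F * aeval (MvPolynomial.X i) f) = 0 := by
  induction F using MvPolynomial.induction_on' with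
  | add p q hp hq => rw [add_mul, map_add, hp, hq, add_zero]
  | monomial a c =>
    have h1 : MvPolynomial.monomial a c * aeval (MvPolynomial.X i) f =
        c • ∏ j, aeval (MvPolynomial.X j : MvPolynomial (Fin r) R)
          (X ^ a j * if j = i then f else 1) := by
      simp only [map_mul, Finset.prod_mul_distrib, map_pow, aeval_X]
      rw [MvPolynomial.monomial_eq, Finsupp.prod_fintype _ _ (by simp), MvPolynomial.smul_eq_C_mul,
        mul_assoc]
      congr 2
      rw [Finset.prod_eq_single i] <;> simp +contextual
    rw [h1, map_smul, tensorAction_prod, MultilinearMap.map_coord_zero _ i, smul_zero]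
    rw [if_pos rfl, map_mul, Module.End.mul_apply, hf, map_zero]

end TensorAction

/-! ### Weil operators -/

section WeilOperator

variable {Fq : Type*} [Field Fq] {A : Type*} [CommRing A] [Algebra Fq A]

/-- `O_𝔣⁽²⁾(x, X) = ∑_k D_𝔣(x^k) X^k`, as a polynomial in the last variable. -/
def weilTwo (f : Fq[X]) (x : A) : A[X] :=
  ∑ k ∈ Finset.range f.natDegree, C (aeval x (dualPoly f k)) * X ^ k

/-- `O_𝔣⁽²⁾(x, X)` is the difference quotient `(𝔣(X) - 𝔣(x)) / (X - x)`. -/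
lemma X_sub_C_mul_weilTwo (f : Fq[X]) (x : A) :
    (X - C x) * weilTwo f x = f.map (algebraMap Fq A) - C (aeval x f) := by
  -- multiplying by `x` shifts the coefficients down, so that the sum telescopes
  have h : ∀ m ≤ f.natDegree, (X - C x) *
      ∑ k ∈ Finset.range m, C (aeval x (dualPoly f k)) * X ^ k =
      ∑ k ∈ Finset.range (m + 1), C (algebraMap Fq A (f.coeff k)) * X ^ k - C (aeval x f) +
        C x * C (aeval x (dualPoly f m)) * X ^ m := by
    intro m
    induction m with
    | zero =>
      intro _
      have h0 := congrArg (aeval x) (X_mul_dualPoly_zero_add f)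
      rw [map_add, map_mul, aeval_X, aeval_C] at h0
      rw [← h0]
      simp
    | succ m ih =>
      intro hm
      have h1 := congrArg (aeval x) (dualPoly_succ f (i := m) (by omega))
      rw [map_add, map_mul, aeval_X, aeval_C] at h1
      rw [Finset.sum_range_succ, mul_add, ih (by omega), Finset.sum_range_succ _ (m + 1), h1]
      simp only [C_add, C_mul]
      ring
  rw [weilTwo, h _ le_rfl]
  have h2 : dualPoly f f.natDegree = 0 := by simp [dualPoly]
  rw [h2]
  have h3 : f.map (algebraMap Fq A) =
      ∑ k ∈ Finset.range (f.natDegree + 1), C (algebraMap Fq A (f.coeff k)) * X ^ k := by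
    conv_lhs => rw [as_sum_range_C_mul_X_pow f]
    simp [Polynomial.map_sum]
  rw [h3, map_zero, C_0, mul_zero, zero_mul, add_zero]

lemma coeff_weilTwo (f : Fq[X]) (x : A) (j : ℕ) :
    (weilTwo f x).coeff j = if j < f.natDegree then aeval x (dualPoly f j) else 0 := by
  simp [weilTwo, finsetSum_coeff, coeff_X_pow]

/-- The reproducing property of `O_𝔣⁽²⁾`: modulo `𝔣(x)`, the top coefficient of
`P(X) O_𝔣⁽²⁾(x, X)`, reduced modulo `𝔣(X)`, is `P(x)`. -/
lemma coeff_mul_weilTwo_modByMonic {f : Fq[X]} (hf : f.Monic) (hn : 0 < f.natDegree) (x : A)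
    (P : A[X]) : aeval x f ∣
      (P * weilTwo f x %ₘ f.map (algebraMap Fq A)).coeff (f.natDegree - 1) - P.eval x := by
  nontriviality A
  set g := f.map (algebraMap Fq A)
  have hg : g.Monic := hf.map _
  obtain ⟨Q, hQ⟩ := X_sub_C_dvd_sub_C_eval (a := x) (p := P)
  have h1 : P * weilTwo f x = P.eval x • weilTwo f x + Q * g - aeval x f • Q := by
    have h := X_sub_C_mul_weilTwo f x
    rw [smul_eq_C_mul, smul_eq_C_mul]
    linear_combination weilTwo f x * hQ + Q * h
  have h2 : weilTwo f x %ₘ g = weilTwo f x := by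
    rw [modByMonic_eq_self_iff hg, hf.degree_map, degree_eq_natDegree hf.ne_zero,
      degree_lt_iff_coeff_zero]
    intro m hm
    rw [coeff_weilTwo, if_neg (not_lt.mpr hm)]
  have h3 : dualPoly f (f.natDegree - 1) = 1 := by
    have h : f.natDegree - (f.natDegree - 1) = 1 := by omega
    have h' : f.natDegree - 1 + 0 + 1 = f.natDegree := by omega
    rw [dualPoly, h, Finset.sum_range_one, h', hf.coeff_natDegree]
    simp
  refine ⟨-(Q %ₘ g).coeff (f.natDegree - 1), ?_⟩
  rw [h1, sub_modByMonic, add_modByMonic, smul_modByMonic, smul_modByMonic, h2,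
    mul_self_modByMonic hg, add_zero, coeff_sub, coeff_smul, coeff_smul, coeff_weilTwo,
    if_pos (by omega), h3, map_one, smul_eq_mul, smul_eq_mul]
  ring

lemma weilProd_eq (f : Fq[X]) (s : ℕ) :
    weilProd f s = ∏ j : Fin s, weilTwo f (MvPolynomial.X j : MvPolynomial (Fin s) Fq) := rfl

lemma map_weilTwo {B : Type*} [CommRing B] [Algebra Fq B] (f : Fq[X]) (h : A →ₐ[Fq] B) (x : A) :
    (weilTwo f x).map (h : A →+* B) = weilTwo f (h x) := by
  simp [weilTwo, Polynomial.map_sum, ← aeval_algHom_apply]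

/-- Lowering the rank: modulo `𝔣(X_r)`, the operator `O_𝔣⁽ʳ⁾` is the coefficient of `t^(n-1)` in
`O_𝔣⁽ʳ⁺¹⁾(X_1, …, X_r, t)`. -/
lemma coeff_weilProd_modByMonic {f : Fq[X]} (hf : f.Monic) (hn : 0 < f.natDegree) (s : ℕ) :
    aeval (MvPolynomial.X (Fin.last s)) f ∣
      (weilProd f (s + 1) %ₘ f.map MvPolynomial.C).coeff (f.natDegree - 1) -
        weilOp f (s + 1) := by
  set x : MvPolynomial (Fin (s + 1)) Fq := MvPolynomial.X (Fin.last s)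
  set ren : MvPolynomial (Fin s) Fq →ₐ[Fq] MvPolynomial (Fin (s + 1)) Fq :=
    MvPolynomial.rename Fin.castSucc
  have h1 : weilProd f (s + 1) = (weilProd f s).map (ren : _ →+* _) * weilTwo f x := by
    rw [weilProd_eq, weilProd_eq, Fin.prod_univ_castSucc, Polynomial.map_prod]
    congr 1
    refine Finset.prod_congr rfl fun j _ => ?_
    rw [map_weilTwo]
    simp [ren]
  have h2 := coeff_mul_weilTwo_modByMonic hf hn x ((weilProd f s).map (ren : _ →+* _))
  have h3 : aeval x f ∣ ((weilProd f s).map (ren : _ →+* _)).eval x - weilOp f (s + 1) := by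
    have h4 : weilOp f (s + 1) =
        eval₂ (ren : _ →+* _) x (weilProd f s %ₘ f.map MvPolynomial.C) := rfl
    rw [eval_map, h4, modByMonic_eq_sub_mul_div, eval₂_sub, sub_sub_cancel, eval₂_mul, eval₂_map]
    have h6 : aeval x f = eval₂ ((ren : MvPolynomial (Fin s) Fq →+*
        MvPolynomial (Fin (s + 1)) Fq).comp MvPolynomial.C) x f := by
      rw [aeval_def]
      congr 1
      ext a
      simp [ren, MvPolynomial.algebraMap_eq]
    rw [h6]
    exact dvd_mul_right _ _
  rw [← h1] at h2
  have h5 := dvd_add h2 h3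
  rw [sub_add_sub_cancel] at h5
  exact h5

/-- The substitution `X ↦ t`, moving the last variable into the coefficients. -/
def lastVarHom (r : ℕ) :
    (MvPolynomial (Fin r) Fq)[X] →+* MvPolynomial (Fin r) Fq[X] :=
  eval₂RingHom (MvPolynomial.map C) (MvPolynomial.C X)

lemma lastVarHom_map_C (r : ℕ) (p : Fq[X]) :
    lastVarHom r (p.map MvPolynomial.C) = MvPolynomial.C p := by
  rw [lastVarHom, coe_eval₂RingHom, eval₂_map]
  have h : (MvPolynomial.map C).comp MvPolynomial.C =
      (MvPolynomial.C : Fq[X] →+* MvPolynomial (Fin r) Fq[X]).comp (C : Fq →+* Fq[X]) := by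
    ext a; simp
  rw [h, ← hom_eval₂, eval₂_C_X]

lemma lastVarToT_weilOp (f : Fq[X]) (r : ℕ) :
    lastVarToT (weilOp f (r + 1)) = lastVarHom r (weilProd f r %ₘ f.map MvPolynomial.C) := by
  rw [lastVarToT, weilOp, lastVarHom, coe_eval₂RingHom]
  generalize weilProd f r %ₘ f.map MvPolynomial.C = W
  refine (hom_eval₂ W _ (MvPolynomial.aeval _ : _ →ₐ[Fq] _).toRingHom _).trans ?_
  congr 1
  · ext i <;> simp [MvPolynomial.algebraMap_eq]
  · simp

end WeilOperator

/-! ### Difference equations for Moore determinants -/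

section MooreTwist

variable {R S : Type*} [CommRing R] [CommRing S] [Algebra R S]

/-- If all `ω_i` are solutions of one linear `τ`-difference equation `∑_{j ≤ r} g_j τ^j(ω) = t ω`,
then their Moore determinant solves an equation of order one. -/
lemma mul_map_moore_tprod (τ : S →ₐ[R] S) {r : ℕ} (hr : 0 < r) (g : Fin (r + 1) → S) (t : S)
    (ω : Fin r → S) (h : ∀ i, ∑ j : Fin (r + 1), g j * (τ ^ (j : ℕ)) (ω i) = t * ω i) :
    g (Fin.last r) * τ (moore τ r (PiTensorProduct.tprod R ω)) =
      (-1) ^ (r - 1) * (t - g 0) * moore τ r (PiTensorProduct.tprod R ω) := by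
  obtain ⟨s, rfl⟩ : ∃ s, r = s + 1 := ⟨r - 1, by omega⟩
  rw [moore_tprod]
  set V : Matrix (Fin (s + 1)) (Fin (s + 1)) S := Matrix.of fun j i => (τ ^ (j : ℕ)) (ω i)
  -- the rows `τ ω, …, τ^s ω, ω`: only the last one has to change to give the twist of `V`
  set A := V.submatrix (finRotate (s + 1)) id
  have hA : A.det = (-1) ^ s * V.det := by
    rw [Matrix.det_permute, sign_finRotate]
    simp
  have hτ : τ V.det = (A.updateRow (Fin.last s) fun i => (τ ^ (s + 1)) (ω i)).det := by
    rw [AlgHom.map_det]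
    congr 1
    ext j i
    rw [AlgHom.mapMatrix_apply, Matrix.map_apply]
    have hstep : τ (V j i) = (τ ^ ((j : ℕ) + 1)) (ω i) := by
      rw [pow_succ', AlgHom.mul_apply]; rfl
    rw [hstep]
    by_cases hj : j = Fin.last s
    · subst hj
      rw [Matrix.updateRow_self, Fin.val_last]
    · rw [Matrix.updateRow_ne hj]
      change _ = (τ ^ ((finRotate (s + 1) j : Fin (s + 1)) : ℕ)) (ω i)
      rw [coe_finRotate_of_ne_last hj]
  have hrow : (g (Fin.last (s + 1)) • fun i => (τ ^ (s + 1)) (ω i)) =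
      ∑ k, (if k = Fin.last s then t - g 0 else -g k.succ) • A k := by
    ext i
    have hi := h i
    rw [Fin.sum_univ_succ, Fin.sum_univ_castSucc] at hi
    have hAk : ∀ k : Fin s, A k.castSucc i = (τ ^ ((k : ℕ) + 1)) (ω i) := by
      intro k
      change (τ ^ ((finRotate (s + 1) k.castSucc : Fin (s + 1)) : ℕ)) (ω i) = _
      rw [coe_finRotate_of_ne_last (Fin.castSucc_lt_last k).ne, Fin.val_castSucc]
    have hAl : A (Fin.last s) i = ω i := by
      change (τ ^ ((finRotate (s + 1) (Fin.last s) : Fin (s + 1)) : ℕ)) (ω i) = _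
      rw [finRotate_last]
      simp
    have hne : ∀ k : Fin s, k.castSucc ≠ Fin.last s := fun k => (Fin.castSucc_lt_last k).ne
    rw [Finset.sum_apply, Fin.sum_univ_castSucc]
    simp only [Pi.smul_apply, smul_eq_mul, hAk, hAl, hne, if_true, if_false, neg_mul,
      Finset.sum_neg_distrib]
    simp only [Fin.val_zero, pow_zero, AlgHom.one_apply, Fin.val_succ, Fin.val_castSucc,
      Fin.val_last, Fin.succ_last] at hi
    linear_combination hi
  rw [hτ, ← Matrix.det_updateRow_smul, hrow, Matrix.det_updateRow_sum, if_pos rfl, hA]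
  simp only [smul_eq_mul, Nat.add_sub_cancel]
  ring

end MooreTwist

/-! ### Moore determinants of remainders, and the action on coefficients -/

section Drinfeld

variable {Fq : Type*} [Field Fq] [Fintype Fq]

attribute [local instance] Polynomial.algebra

lemma coeff_twistPowerSeries_pow (j k : ℕ) (ω : (CInf Fq)⟦X⟧) :
    PowerSeries.coeff k ((twistPowerSeries Fq ^ j) ω) =
      PowerSeries.coeff k ω ^ Fintype.card Fq ^ j := by
  induction j with
  | zero => simp
  | succ j ih =>
    rw [pow_succ', AlgHom.mul_apply, twistPowerSeries, PowerSeries.mapAlgHom_apply,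
      PowerSeries.coeff_map, ← twistPowerSeries, ih, pow_succ, pow_mul]
    simp

lemma twistPowerSeries_pow_mem_tateAlgebra (j : ℕ) {ω : (CInf Fq)⟦X⟧}
    (hω : ω ∈ tateAlgebra Fq) : (twistPowerSeries Fq ^ j) ω ∈ tateAlgebra Fq := by
  induction j with
  | zero => simpa
  | succ j ih =>
    rw [pow_succ', AlgHom.mul_apply]
    exact twistPowerSeries_mem_tateAlgebra ih

lemma twistPoly_pow_remainder {f : Fq[X]} (hf : f.Monic) (j : ℕ) {ω : (CInf Fq)⟦X⟧}
    (hω : ω ∈ tateAlgebra Fq) :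
    (twistPoly Fq ^ j) (remainder f ω) = remainder f ((twistPowerSeries Fq ^ j) ω) := by
  induction j with
  | zero => simp
  | succ j ih =>
    rw [pow_succ', AlgHom.mul_apply, ih, pow_succ', AlgHom.mul_apply,
      twistPoly_remainder hf (twistPowerSeries_pow_mem_tateAlgebra j hω)]

/-- The Moore determinant of elements of the Tate algebra, as an element of the Tate algebra. -/
def tateMoore {r : ℕ} (ω : Fin r → tateAlgebra Fq) : tateAlgebra Fq :=
  (Matrix.of fun j i : Fin r => (⟨(twistPowerSeries Fq ^ (j : ℕ)) (ω i),
    twistPowerSeries_pow_mem_tateAlgebra _ (ω i).2⟩ : tateAlgebra Fq)).det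

lemma coe_tateMoore {r : ℕ} (ω : Fin r → tateAlgebra Fq) : (tateMoore ω : (CInf Fq)⟦X⟧) =
    moore (twistPowerSeries Fq) r (PiTensorProduct.tprod Fq fun i => (ω i : (CInf Fq)⟦X⟧)) := by
  rw [tateMoore, moore_tprod]
  exact RingHom.map_det (tateAlgebra Fq).subtype _

/-- Remainders are compatible with Moore determinants, modulo `𝔣`. -/
lemma map_dvd_remainder_moore_sub {f : Fq[X]} (hf : f.Monic) {r : ℕ} (ω : Fin r → tateAlgebra Fq) :
    f.map (algebraMap Fq (CInf Fq)) ∣ remainder f (tateMoore ω : (CInf Fq)⟦X⟧) -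
      moore (twistPoly Fq) r (PiTensorProduct.tprod Fq[X] fun i =>
        remainder f (ω i : (CInf Fq)⟦X⟧)) := by
  rw [← mk_eq_mk_iff_map_dvd]
  change evalQuotient hf (tateMoore ω) = _
  rw [tateMoore, moore_tprod, RingHom.map_det, RingHom.map_det]
  congr 1
  ext j i
  simp only [RingHom.mapMatrix_apply, Matrix.map_apply, Matrix.of_apply]
  rw [twistPoly_pow_remainder hf _ (ω i).2]
  rfl

namespace DrinfeldModule

variable {r : ℕ} (φ : DrinfeldModule Fq r)

lemma act_eq_tensorAction (F : MvPolynomial (Fin r) Fq) (μ : Fin r → CInf Fq) :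
    φ.act F μ = tensorAction φ.phiX μ F := by
  rw [tensorAction_apply, act]
  simp [phi]

/-- The operator `φ_x` on `ℂ_∞[t]`, acting on coefficients. -/
def phiXPoly : Module.End Fq[X] (CInf Fq)[X] :=
  ∑ i : Fin (r + 1), (LinearMap.mulLeft Fq[X] (C (φ.g i))).comp
    (twistPoly Fq ^ (i : ℕ)).toLinearMap

lemma twistPoly_pow_C (j : ℕ) (c : CInf Fq) :
    (twistPoly Fq ^ j) (C c) = C (((frob Fq) ^ j) c) := by
  induction j with
  | zero => simp
  | succ j ih =>
    rw [pow_succ', AlgHom.mul_apply, ih, pow_succ', AlgHom.mul_apply]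
    simp [twistPoly]

lemma phiXPoly_C (c : CInf Fq) : φ.phiXPoly (C c) = C (φ.phiX c) := by
  rw [phiX_apply, phiXPoly, LinearMap.sum_apply, map_sum]
  refine Finset.sum_congr rfl fun i _ => ?_
  rw [LinearMap.comp_apply, AlgHom.toLinearMap_apply, twistPoly_pow_C, LinearMap.mulLeft_apply,
    C_mul, frob_pow_apply]

lemma phiXPoly_pow_C (k : ℕ) (c : CInf Fq) : (φ.phiXPoly ^ k) (C c) = C (φ.phi (X ^ k) c) := by
  induction k with
  | zero => simp
  | succ k ih =>
    rw [pow_succ', Module.End.mul_apply, ih, phiXPoly_C, pow_succ', map_mul, Module.End.mul_apply]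
    simp [phi]

lemma aeval_phiXPoly_map_C (p : Fq[X]) (c : CInf Fq) :
    aeval φ.phiXPoly (p.map C) (C c) = C (φ.phi p c) := by
  induction p using Polynomial.induction_on' with
  | add p q hp hq => simp [hp, hq]
  | monomial k a =>
    rw [← C_mul_X_pow_eq_monomial, Polynomial.map_mul, map_mul, map_mul, Module.End.mul_apply,
      Module.End.mul_apply]
    have hC : ∀ x, φ.phi (C a) x = algebraMap Fq (CInf Fq) a * x := by
      intro x
      rw [phi, aeval_C, Module.algebraMap_end_apply, Algebra.smul_def]
    simp [phiXPoly_pow_C, Module.algebraMap_end_apply, Algebra.smul_def,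
      Polynomial.algebraMap_def, hC]

lemma actT_eq_tensorAction (F : MvPolynomial (Fin r) Fq[X]) (μ : Fin r → CInf Fq) :
    φ.actT F μ = tensorAction φ.phiXPoly (fun i => C (μ i)) F := by
  rw [tensorAction_apply, actT]
  simp [phiXPoly_pow_C]

end DrinfeldModule

end Drinfeld

/-! ### Values of the Weil operators -/

section Drinfeld

variable {Fq : Type*} [Field Fq] [Fintype Fq]

attribute [local instance] Polynomial.algebra

namespace DrinfeldModule

variable {r : ℕ} (φ : DrinfeldModule Fq r)

lemma mooreT_tensorAction_map_C (F : MvPolynomial (Fin r) Fq) (μ : Fin r → CInf Fq) :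
    mooreT (tensorAction φ.phiXPoly (fun i => C (μ i)) (MvPolynomial.map C F)) =
      C (moore (frob Fq) r (tensorAction φ.phiX μ F)) := by
  rw [mooreT]
  induction F using MvPolynomial.induction_on' with
  | add p q hp hq => simp only [map_add, hp, hq]
  | monomial a c =>
    have hdet : (Matrix.of fun j i : Fin r => (twistPoly Fq ^ (j : ℕ))
        ((φ.phiXPoly ^ a i) (C (μ i)))).det =
        C (Matrix.of fun j i : Fin r => ((frob Fq) ^ (j : ℕ)) ((φ.phiX ^ a i) (μ i))).det := by
      rw [RingHom.map_det]
      congr 1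
      ext1 j i
      simp [phiXPoly_pow_C, twistPoly_pow_C, phi]
    rw [MvPolynomial.map_monomial, tensorAction_monomial, tensorAction_monomial, map_smul, map_smul,
      moore_tprod, moore_tprod, hdet, Algebra.smul_def, Algebra.smul_def, Polynomial.algebraMap_def,
      coe_mapRingHom, Polynomial.map_C, C_mul]

/-- The `t`-expansion of the action of `F(X_1, …, X_r, t)`, coefficient by coefficient. -/
lemma coeff_mooreT_actT (W : (MvPolynomial (Fin r) Fq)[X]) (μ : Fin r → CInf Fq) (k : ℕ) :
    (mooreT (φ.actT (lastVarHom r W) μ)).coeff k = moore (frob Fq) r (φ.act (W.coeff k) μ) := by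
  rw [act_eq_tensorAction, actT_eq_tensorAction]
  induction W using Polynomial.induction_on' with
  | add p q hp hq =>
    rw [mooreT] at hp hq ⊢
    simp only [map_add, coeff_add, hp, hq]
  | monomial m p =>
    have h : lastVarHom r (monomial m p) = (X ^ m : Fq[X]) • MvPolynomial.map C p := by
      rw [lastVarHom, coe_eval₂RingHom, eval₂_monomial, MvPolynomial.smul_eq_C_mul, map_pow,
        mul_comm]
    have h1 := φ.mooreT_tensorAction_map_C p μ
    rw [mooreT] at h1 ⊢
    rw [h, map_smul, map_smul, h1, Algebra.smul_def, Polynomial.algebraMap_def, coe_mapRingHom,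
      Polynomial.map_pow, map_X, coeff_monomial, mul_comm, coeff_C_mul_X_pow]
    by_cases hk : k = m
    · simp [hk]
    · simp [hk, Ne.symm hk]

/-- The unreduced product `∏_i O_𝔣⁽²⁾(X_i, t)` produces the Moore determinant of the remainders of
the eigenfunctions. -/
lemma actT_lastVarHom_weilProd {f : Fq[X]} (hf : f.Monic) (hn : 0 < f.natDegree)
    (ω : Fin r → (CInf Fq)⟦X⟧) (hω : ∀ i, ω i ∈ tateAlgebra Fq)
    (h : ∀ i k, φ.phiX (PowerSeries.coeff k (ω i)) = PowerSeries.coeff k (PowerSeries.X * ω i)) :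
    φ.actT (lastVarHom r (weilProd f r)) (fun i => (remainder f (ω i)).coeff (f.natDegree - 1)) =
      PiTensorProduct.tprod Fq[X] fun i => remainder f (ω i) := by
  set P : Fq[X][X] := ∑ k ∈ Finset.range f.natDegree, C (X ^ k) * (dualPoly f k).map C
  have h1 : lastVarHom r (weilProd f r) = ∏ i, aeval (MvPolynomial.X i) P := by
    rw [weilProd_eq, map_prod]
    refine Finset.prod_congr rfl fun i _ => ?_
    rw [weilTwo, map_sum, map_sum]
    refine Finset.sum_congr rfl fun k _ => ?_
    rw [map_mul, map_mul, map_pow, mul_comm]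
    congr 1
    · simp [lastVarHom, MvPolynomial.algebraMap_eq]
    · generalize dualPoly f k = D
      induction D using Polynomial.induction_on' with
      | add p q hp hq => simp only [map_add, Polynomial.map_add, hp, hq]
      | monomial m a =>
        simp [lastVarHom, ← C_mul_X_pow_eq_monomial, MvPolynomial.algebraMap_eq, eval₂_pow]
  rw [actT_eq_tensorAction, h1, tensorAction_prod]
  congr 1
  funext i
  rw [map_sum, LinearMap.sum_apply]
  conv_rhs => rw [remainder_eq_sum]
  refine Finset.sum_congr rfl fun k hk => ?_
  have hk' := (Finset.mem_range.mp hk)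
  rw [map_mul, Module.End.mul_apply, aeval_phiXPoly_map_C,
    ← φ.coeff_remainder_eq_phi_dualPoly hf hn (hω i) (h i) hk'.le, aeval_C,
    Module.algebraMap_end_apply, Algebra.smul_def, Polynomial.algebraMap_def, coe_mapRingHom,
    Polynomial.map_pow, map_X, mul_comm]

/-- The remainder of the Moore determinant of eigenfunctions is given by the Weil operator: reducing
`∏_i O_𝔣⁽²⁾(X_i, t)` modulo `𝔣(t)` changes the result by a multiple of `𝔣(t)`, since the action is
`𝔽_q[t]`-linear, and brings its degree in `t` below `n`. -/
lemma remainder_moore_eq {f : Fq[X]} (hf : f.Monic) (hn : 0 < f.natDegree)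
    (ω : Fin r → tateAlgebra Fq)
    (h : ∀ i k, φ.phiX (PowerSeries.coeff k (ω i : (CInf Fq)⟦X⟧)) =
      PowerSeries.coeff k (PowerSeries.X * (ω i : (CInf Fq)⟦X⟧))) :
    remainder f (tateMoore ω : (CInf Fq)⟦X⟧) =
      mooreT (φ.actT (lastVarHom r (weilProd f r %ₘ f.map MvPolynomial.C))
        fun i => (remainder f (ω i : (CInf Fq)⟦X⟧)).coeff (f.natDegree - 1)) := by
  have hg : (f.map (MvPolynomial.C : Fq →+* MvPolynomial (Fin r) Fq)).Monic := hf.map _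
  refine eq_of_map_dvd_sub hf (fun j hj => coeff_remainder_of_le f _ hj) (fun j hj => ?_) ?_
  · have h0 : (weilProd f r %ₘ f.map MvPolynomial.C).coeff j = 0 :=
      coeff_eq_zero_of_degree_lt ((degree_modByMonic_lt _ hg).trans_le (by
        rw [hf.degree_map, degree_eq_natDegree hf.ne_zero]
        exact_mod_cast hj))
    rw [coeff_mooreT_actT, h0, act_eq_tensorAction, map_zero, map_zero]
  · have h1 := map_dvd_remainder_moore_sub hf ω
    rw [← φ.actT_lastVarHom_weilProd hf hn _ (fun i => (ω i).2) h] at h1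
    refine (dvd_iff_dvd_of_dvd_sub ?_).mp h1
    set μ := fun i => (remainder f (ω i : (CInf Fq)⟦X⟧)).coeff (f.natDegree - 1)
    rw [sub_sub_sub_cancel_left, mooreT, modByMonic_eq_sub_mul_div, map_sub, map_mul,
      lastVarHom_map_C, actT_eq_tensorAction, actT_eq_tensorAction, map_sub, map_sub,
      ← MvPolynomial.smul_eq_C_mul, map_smul, map_smul, sub_sub_cancel_left, Algebra.smul_def,
      Polynomial.algebraMap_def, coe_mapRingHom]
    exact (dvd_mul_right _ _).neg_right

/-- The functional equation `ψ_x(κ) = t κ`. -/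
lemma phiX_exteriorProduct_coeff_moore (ω : Fin r → (CInf Fq)⟦X⟧)
    (h : ∀ i k, φ.phiX (PowerSeries.coeff k (ω i)) = PowerSeries.coeff k (PowerSeries.X * ω i))
    (k : ℕ) :
    φ.exteriorProduct.phiX (PowerSeries.coeff k
        (moore (twistPowerSeries Fq) r (PiTensorProduct.tprod Fq ω))) =
      PowerSeries.coeff k (PowerSeries.X *
        moore (twistPowerSeries Fq) r (PiTensorProduct.tprod Fq ω)) := by
  set κ := moore (twistPowerSeries Fq) r (PiTensorProduct.tprod Fq ω) with hκ
  have h1 := mul_map_moore_tprod (twistPowerSeries Fq) φ.rank_pos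
    (fun j => PowerSeries.C (φ.g j)) PowerSeries.X ω (fun i => by
      ext k
      rw [← h i k, phiX_apply, map_sum]
      simp only [PowerSeries.coeff_C_mul, coeff_twistPowerSeries_pow])
  rw [← hκ] at h1
  have h2 : PowerSeries.C (theta Fq) * κ +
      PowerSeries.C ((-1) ^ (r - 1) * φ.g (Fin.last r)) * (twistPowerSeries Fq ^ 1) κ =
      PowerSeries.X * κ := by
    have h3 : ((-1 : (CInf Fq)⟦X⟧) ^ (r - 1)) * (-1) ^ (r - 1) = 1 := by
      rw [← mul_pow]; simp
    rw [φ.g_zero] at h1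
    rw [pow_one, map_mul, map_pow, map_neg, map_one]
    linear_combination (-1) ^ (r - 1) * h1 + (PowerSeries.X - PowerSeries.C (theta Fq)) * κ * h3
  rw [← h2, phiX_apply, Fin.sum_univ_two, map_add, PowerSeries.coeff_C_mul, PowerSeries.coeff_C_mul,
    coeff_twistPowerSeries_pow]
  simp [exteriorProduct]

/-- On `𝔣`-torsion, `O_𝔣⁽ʳ⁾` acts as the coefficient of `t^(n-1)` in `O_𝔣⁽ʳ⁺¹⁾(X_1, …, X_r, t)`. -/
lemma act_weilOp_eq {f : Fq[X]} (hf : f.Monic) (hn : 0 < f.natDegree) (μ : Fin r → φ.torsion f) :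
    φ.act ((weilProd f r %ₘ f.map MvPolynomial.C).coeff (f.natDegree - 1)) (fun i => μ i) =
      φ.act (weilOp f r) fun i => μ i := by
  obtain ⟨s, rfl⟩ : ∃ s, r = s + 1 := ⟨r - 1, by have := φ.rank_pos; omega⟩
  obtain ⟨G, hG⟩ := coeff_weilProd_modByMonic hf hn s
  rw [act_eq_tensorAction, act_eq_tensorAction, ← sub_eq_zero, ← map_sub, hG, mul_comm]
  have hμ : aeval φ.phiX f (μ (Fin.last s) : CInf Fq) = 0 := (μ (Fin.last s)).2
  rw [tensorAction_mul_eq_zero φ.phiX (fun i => (μ i : CInf Fq)) _ hμ]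

end DrinfeldModule

end Drinfeld

end DrinfeldWeil

end

theorem theorem4 {Fq : Type*} [Field Fq] [Fintype Fq] {r : ℕ}
    (φ : DrinfeldWeil.DrinfeldModule Fq r)
    (f : Polynomial Fq) (hf : f.Monic) (hn : 0 < f.natDegree)
    (z : Fin r → DrinfeldWeil.CInf Fq) (hz : ∀ i, z i ∈ φ.lattice) :
    (∀ μ, Summable fun i => φ.expCoeff i * μ ^ Fintype.card Fq ^ i) ∧
    (∀ i, φ.omega (z i) ∈ DrinfeldWeil.tateAlgebra Fq) ∧
    φ.kappa z ∈ DrinfeldWeil.tateAlgebra Fq ∧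
    DrinfeldWeil.remainder f (φ.kappa z) =
      DrinfeldWeil.mooreT (φ.actT (DrinfeldWeil.lastVarToT (DrinfeldWeil.weilOp f (r + 1)))
        fun i => φ.remCoeff f (z i) (f.natDegree - 1)) ∧
    ∃ h : ∀ i, φ.remCoeff f (z i) (f.natDegree - 1) ∈ φ.torsion f,
      (DrinfeldWeil.remainder f (φ.kappa z)).coeff (f.natDegree - 1) =
        φ.weilPairing f (fun i => ⟨φ.remCoeff f (z i) (f.natDegree - 1), h i⟩) ∧
      φ.weilPairing f (fun i => ⟨φ.remCoeff f (z i) (f.natDegree - 1), h i⟩) ∈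
        φ.exteriorProduct.torsion f := by
  let ω : Fin r → DrinfeldWeil.tateAlgebra Fq := fun i =>
    ⟨φ.omega (z i), φ.omega_mem_tateAlgebra (z i)⟩
  have hω := fun i => φ.phiX_coeff_omega (hz i)
  have hκ : (DrinfeldWeil.tateMoore ω : PowerSeries (DrinfeldWeil.CInf Fq)) = φ.kappa z :=
    DrinfeldWeil.coe_tateMoore ω
  have hκT : φ.kappa z ∈ DrinfeldWeil.tateAlgebra Fq := hκ ▸ (DrinfeldWeil.tateMoore ω).2
  have hrem := φ.remainder_moore_eq hf hn ω hω
  rw [hκ] at hrem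
  have htors : ∀ i, φ.remCoeff f (z i) (f.natDegree - 1) ∈ φ.torsion f := fun i =>
    φ.coeff_remainder_mem_torsion hf hn (ω i).2 (hω i)
  have hweil : (DrinfeldWeil.remainder f (φ.kappa z)).coeff (f.natDegree - 1) =
      φ.weilPairing f (fun i => ⟨φ.remCoeff f (z i) (f.natDegree - 1), htors i⟩) := by
    rw [hrem, DrinfeldWeil.DrinfeldModule.coeff_mooreT_actT,
      DrinfeldWeil.DrinfeldModule.weilPairing, ← φ.act_weilOp_eq hf hn]
    rfl
  refine ⟨φ.summable_exp, fun i => (ω i).2, hκT, ?_, htors, hweil, ?_⟩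
  · rw [DrinfeldWeil.lastVarToT_weilOp]
    exact hrem
  · rw [← hweil]
    exact φ.exteriorProduct.coeff_remainder_mem_torsion hf hn hκT
      (φ.phiX_exteriorProduct_coeff_moore _ hω)
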